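/- Let $D=(G,\mathcal O,w)$ be a weighted oriented graph: $G$ is a finite simple graph, $\mathcal O$ gives each edge of $G$ one direction, and $w:V(G)\to\{1,2,\dots\}$. Let $E(D)$ be the set of oriented edges, $N_D^+(A)=\{y\mid (x,y)\in E(D)\text{ for some }x\in A\}$ for $A\subseteq V(G)$, $N_D(x)$ the set of neighbours of $x$ in $G$, and $V^+=\{x\mid w(x)>1\}$. Let $K$ be a field and let $I(D)=(xy^{w(y)}\mid (x,y)\in E(D))$ be the edge ideal of $D$ in the polynomial ring over $K$ whose variables are the vertices of $G$. An ideal is unmixed if all its associated primes have the same height. Subgraphs of $D$ carry the inherited orientation and weights. A root oriented tree (ROT) with parent $v$ is a subgraph $T$ of $D$ without cycles, with $v\in V(T)$, such that every $x\in V(T)\setminus\{v\}$ is reached from $v$ by an oriented path in $T$, and every $x\in V(T)$ with $w(x)=1$ satisfies either $\deg_T(x)=1$ and $x\ne v$, or $V(T)=\{v\}$ and $x=v$. A unicycle oriented subgraph is a subgraph $B$ of $D$ with exactly one cycle $C$, such that $C$ is an oriented cycle, every $y\in V(B)\setminus V(C)$ is reached from a vertex of $C$ by an oriented path in $B$, and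 $\deg_B(x)=1$ for every $x\in V(B)$ with $w(x)=1$. A $\star$-semi-forest of $D$ is a subgraph $H=\bigcup_{i=1}^r T_i\cup\bigcup_{j=1}^t B_j$ $(r,t\ge 0)$, where the $T_i$ are ROTs with parents $v_i$ and the $B_j$ are unicycle oriented subgraphs, such that (i) the sets $V(T_1),\dots,V(T_r),V(B_1),\dots,V(B_t)$ are pairwise disjoint; (ii) there are (not necessarily distinct) $u_1,\dots,u_r\in V(G)\setminus V(H)$ with $u_i\in N_D(v_i)$; (iii) the set $\{u_1,\dots,u_r\}$ is the disjoint union of two (possibly empty) sets $W_1,W_2$ such that $W_1$ is stable in $G$, $W_2\subseteq V^+$, $(u_i,v_i)\in E(D)$ whenever $u_i\in W_2$, and $N_D^+(W_2\cup\tilde H)\cap W_1=\emptyset$, where $\tilde H=\{x\in V(H)\mid\deg_H(x)\ge2\}\cup\{v_i\mid\deg_H(v_i)=1\}$. A generating $\star$-semi-forest of a subgraph $H'$ of $D$ is a $\star$-semi-forest $H$ of $D$ with $V(H)=V(H')$. Let $\tau(\cdot)$ denote the minimum cardinality of a vertex cover. A $\tau$-reduction of $G$ is a collection of nonempty, pairwise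 disjoint induced subgraphs $H_1,\dots,H_s$ of $G$ with $V(G)=\bigcup_i V(H_i)$ and $\tau(G)=\sum_i\tau(H_i)$. The graph $G$ is perfect if the chromatic number equals the clique number for every induced subgraph of $G$. Theorem. Suppose that $G$ is perfect. Then there is a proper colouring of the complement $\overline G$ with $s=\chi(\overline G)$ colours such that the subgraphs $H_1,\dots,H_s$ of $G$ induced by its colour classes are complete and form a $\tau$-reduction of $G$. Furthermore, for every $\tau$-reduction $H_1,\dots,H_s$ of $G$ into complete subgraphs (in particular for the one above), $I(D)$ is unmixed if and only if no $H_i$ has a generating $\star$-semi-forest. -/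

import Mathlib

/-- A weighted oriented graph on the vertex set `V`: a simple graph, a choice of exactly one
direction for each of its edges, and positive integer weights on the vertices.
`arc x y` means that `(x, y)` is an oriented edge. -/
structure WeightedOrientedGraph (V : Type*) where
  /-- the underlying simple graph -/
  G : SimpleGraph V
  /-- the oriented edges -/
  arc : V → V → Prop
  /-- the weights -/
  w : V → ℕ
  adj_iff : ∀ x y, G.Adj x y ↔ arc x y ∨ arc y x
  arc_asymm : ∀ x y, arc x y → ¬ arc y x
  one_le_w : ∀ x, 1 ≤ w x

namespace WeightedOrientedGraph

variable {V : Type*}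

/-- The set `V⁺` of vertices of weight greater than one. -/
def heavy (D : WeightedOrientedGraph V) : Set V := {x | 1 < D.w x}

/-- The edge ideal of `D` in the polynomial ring over `K` whose variables are the vertices: it is
generated by the monomials `x * y ^ w(y)` for the oriented edges `(x, y)`. -/
noncomputable def edgeIdeal (D : WeightedOrientedGraph V) (K : Type*) [Field K] :
    Ideal (MvPolynomial V K) :=
  Ideal.span {f | ∃ x y, D.arc x y ∧ f = MvPolynomial.X x * MvPolynomial.X y ^ D.w y}

/-! A weighted oriented subgraph of `D` inherits its orientation and its weights from `D`, so it is
the same thing as a subgraph of the underlying graph, `H : D.G.Subgraph`; its oriented edges are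
the pairs `(x, y)` with `H.Adj x y` and `D.arc x y`. -/

/-- The degree of `x` in the subgraph `H`. -/
noncomputable def deg (D : WeightedOrientedGraph V) (H : D.G.Subgraph) (x : V) : ℕ :=
  (H.neighborSet x).ncard

/-- A walk all of whose steps follow the orientation. -/
def IsOriented (D : WeightedOrientedGraph V) {x y : V} (p : D.G.Walk x y) : Prop :=
  ∀ d ∈ p.darts, D.arc d.fst d.snd

/-- There is an oriented path from `x` to `y` inside the subgraph `H`
(a path of length zero is allowed). -/
def HasOrientedPath (D : WeightedOrientedGraph V) (H : D.G.Subgraph) (x y : V) : Prop :=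
  ∃ p : D.G.Walk x y, p.IsPath ∧ D.IsOriented p ∧ p.toSubgraph ≤ H

/-- The set of (not necessarily oriented) cycles of `H`, each regarded as a subgraph. -/
def cycles (D : WeightedOrientedGraph V) (H : D.G.Subgraph) : Set D.G.Subgraph :=
  {C | C ≤ H ∧ ∃ (x : V) (p : D.G.Walk x x), p.IsCycle ∧ p.toSubgraph = C}

/-- `C` is an oriented cycle. -/
def IsOrientedCycle (D : WeightedOrientedGraph V) (C : D.G.Subgraph) : Prop :=
  ∃ (x : V) (p : D.G.Walk x x), p.IsCycle ∧ D.IsOriented p ∧ p.toSubgraph = C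

/-- `B` is a unicycle oriented subgraph: it has exactly one cycle `C`, this cycle is oriented,
every other vertex is reached from `C` by an oriented path in `B`, and the vertices of weight one
have degree one in `B`. -/
def IsUnicycle (D : WeightedOrientedGraph V) (B : D.G.Subgraph) : Prop :=
  ∃ C : D.G.Subgraph, D.cycles B = {C} ∧
    D.IsOrientedCycle C ∧
    (∀ y ∈ B.verts \ C.verts, ∃ c ∈ C.verts, D.HasOrientedPath B c y) ∧
    ∀ x ∈ B.verts, D.w x = 1 → D.deg B x = 1

/-- `T` is a root oriented tree with parent `v`. -/
def IsROT (D : WeightedOrientedGraph V) (T : D.G.Subgraph) (v : V) : Prop :=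
  v ∈ T.verts ∧
    D.cycles T = ∅ ∧
    (∀ x ∈ T.verts \ {v}, D.HasOrientedPath T v x) ∧
    ∀ x ∈ T.verts, D.w x = 1 → (D.deg T x = 1 ∧ x ≠ v) ∨ (T.verts = {v} ∧ x = v)

/-- For a subgraph `H` and parents `v i`, the set consisting of the vertices of degree at least two
in `H` together with the parents of degree one in `H`. -/
def inner (D : WeightedOrientedGraph V) (H : D.G.Subgraph) {r : ℕ} (v : Fin r → V) : Set V :=
  {x | x ∈ H.verts ∧ 2 ≤ D.deg H x} ∪ {x | ∃ i, x = v i ∧ D.deg H (v i) = 1}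

/-- `H` is a ⋆-semi-forest of `D`: the union of root oriented trees `T i` with parents `v i` and of
unicycle oriented subgraphs `B j`, whose vertex sets partition that of `H`, together with vertices
`u i` outside `H` adjacent to the parents and a partition `W₁`, `W₂` (parts may be empty) of the set
of all `u i` with the required properties. -/
def IsStarSemiForest (D : WeightedOrientedGraph V) (H : D.G.Subgraph) : Prop :=
  ∃ (r t : ℕ) (T : Fin r → D.G.Subgraph) (v : Fin r → V) (B : Fin t → D.G.Subgraph),
    (∀ i, D.IsROT (T i) (v i)) ∧
    (∀ j, D.IsUnicycle (B j)) ∧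
    H = (⨆ i, T i) ⊔ (⨆ j, B j) ∧
    (∀ i i', i ≠ i' → Disjoint (T i).verts (T i').verts) ∧
    (∀ j j', j ≠ j' → Disjoint (B j).verts (B j').verts) ∧
    (∀ i j, Disjoint (T i).verts (B j).verts) ∧
    ∃ u : Fin r → V,
      (∀ i, u i ∉ H.verts ∧ D.G.Adj (v i) (u i)) ∧
      ∃ W₁ W₂ : Set V,
        W₁ ∪ W₂ = Set.range u ∧ Disjoint W₁ W₂ ∧
        D.G.IsIndepSet W₁ ∧
        W₂ ⊆ D.heavy ∧
        (∀ i, u i ∈ W₂ → D.arc (u i) (v i)) ∧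
        ∀ x ∈ W₂ ∪ D.inner H v, ∀ y ∈ W₁, ¬ D.arc x y

/-- The subgraph `K` has a generating ⋆-semi-forest. -/
def HasGeneratingStarSemiForest (D : WeightedOrientedGraph V) (K : D.G.Subgraph) : Prop :=
  ∃ H : D.G.Subgraph, D.IsStarSemiForest H ∧ K.verts = H.verts

end WeightedOrientedGraph

/-- An ideal is unmixed if all its associated primes have the same height. -/
def Ideal.IsUnmixedIdeal {R : Type*} [CommRing R] (I : Ideal R) : Prop :=
  ∀ P ∈ associatedPrimes R (R ⧸ I), ∀ Q ∈ associatedPrimes R (R ⧸ I), P.height = Q.height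

namespace SimpleGraph

variable {V : Type*}

/-- A (finite) graph is perfect if the chromatic number and the clique number agree for each of its
induced subgraphs. -/
def IsPerfectGraph (G : SimpleGraph V) : Prop :=
  ∀ A : Set V, (G.induce A).chromaticNumber = ((G.induce A).cliqueNum : ℕ∞)

/-- `H 0, …, H (s - 1)` is a τ-reduction of `G`: nonempty, pairwise disjoint induced subgraphs which
cover the vertices of `G` and whose vertex cover numbers add up to that of `G`. -/
def IsTauReduction (G : SimpleGraph V) {s : ℕ} (H : Fin s → G.Subgraph) : Prop :=
  (∀ i, (H i).verts.Nonempty) ∧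
    (∀ i, (H i).IsInduced) ∧
    (∀ i j, i ≠ j → Disjoint (H i).verts (H j).verts) ∧
    (⋃ i, (H i).verts) = Set.univ ∧
    G.vertexCoverNum = ∑ i, (H i).coe.vertexCoverNum

end SimpleGraph

/-! Exponents turn a witness of an associated prime of `I(D)` into a single monomial, so the
associated primes are generated by the strong vertex covers, and `I(D)` is unmixed if and only if
all strong covers have the same size. A set of vertices lies in a strong cover if and only if it is
spanned by a ⋆-semi-forest: a strong cover supplies each vertex of the set either with a parent in
the set, from which an arc of a heavy vertex comes, or with a vertex `u` outside the set, and the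
components of the resulting functional graph are the trees and the unicycles. A vertex cover misses
at most one vertex of each part of a τ-reduction into complete subgraphs, and it has the least size
exactly when it misses one vertex of every part. Parts of this kind exist as soon as the complement
has a colouring with as many colours as the largest stable set of `G` has elements, which holds
because the complement of a perfect graph is perfect. -/

section MonomialIdeals

open MvPolynomial

variable {σ R : Type*} [CommRing R]

theorem exists_add_eq_of_exponents (p : (σ →₀ ℕ) → Prop) (f : MvPolynomial σ R) :
    ∃ g h, g + h = f ∧ (∀ m ∈ g.support, m ∈ f.support ∧ p m) ∧ ∀ m ∈ h.support, ¬ p m := by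
  classical
  obtain ⟨g, hg⟩ : ∃ g : MvPolynomial σ R, ∀ m, coeff m g = if p m then coeff m f else 0 := by
    refine ⟨∑ m ∈ f.support with p m, monomial m (coeff m f), fun m => ?_⟩
    simp only [coeff_sum, coeff_monomial, Finset.sum_ite_eq', Finset.mem_filter, mem_support_iff]
    by_cases h : coeff m f = 0 <;> simp [h]
  refine ⟨g, f - g, add_sub_cancel g f, fun m hm => ?_, fun m hm hpm => ?_⟩
  · rw [mem_support_iff, hg] at hm
    exact ⟨mem_support_iff.2 (ite_ne_right_iff.1 hm).2, (ite_ne_right_iff.1 hm).1⟩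
  · rw [mem_support_iff, coeff_sub, hg, if_pos hpm, sub_self] at hm
    exact hm rfl

theorem span_X_image_eq_ker_killCompl (C : Set σ) :
    Ideal.span (X '' C : Set (MvPolynomial σ R)) =
      RingHom.ker (killCompl (R := R) (Subtype.val_injective (p := (· ∈ Cᶜ)))) := by
  ext f
  rw [mem_ideal_span_X_image, RingHom.mem_ker, MvPolynomial.ext_iff]
  simp only [coeff_killCompl, coeff_zero]
  refine ⟨fun h s => ?_, fun h m hm => ?_⟩
  · by_contra hs
    obtain ⟨x, hxC, hx⟩ := h _ (mem_support_iff.2 hs)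
    exact hx (Finsupp.mapDomain_of_notMem_range s x (by simpa using hxC))
  · by_contra! hmC
    have hsub : (m.support : Set σ) ⊆ Set.range ((↑) : ↥Cᶜ → σ) := fun x hx => by
      simpa using fun hxC => (Finsupp.mem_support_iff.1 hx) (hmC x hxC)
    have hcoeff := h (m.comapDomain _ Subtype.val_injective.injOn)
    rw [Finsupp.mapDomain_comapDomain _ Subtype.val_injective m hsub] at hcoeff
    exact mem_support_iff.1 hm hcoeff

theorem isPrime_span_X_image [IsDomain R] (C : Set σ) :
    (Ideal.span (X '' C : Set (MvPolynomial σ R))).IsPrime :=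
  span_X_image_eq_ker_killCompl (R := R) C ▸ RingHom.ker_isPrime _

theorem X_mem_span_X_image_iff [Nontrivial R] {C : Set σ} {x : σ} :
    (X x : MvPolynomial σ R) ∈ Ideal.span (X '' C : Set (MvPolynomial σ R)) ↔ x ∈ C := by
  classical
  rw [mem_ideal_span_X_image, support_X]
  simp [Finsupp.single_apply]

theorem span_X_image_strictMono [Nontrivial R] :
    StrictMono fun C : Set σ => Ideal.span (X '' C : Set (MvPolynomial σ R)) := by
  refine Monotone.strictMono_of_injective (fun _ _ h => Ideal.span_mono (Set.image_mono h))
    fun C C' h => Set.ext fun x => ?_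
  rw [← X_mem_span_X_image_iff (R := R), h, X_mem_span_X_image_iff]

theorem height_span_X_image [IsDomain R] [IsNoetherianRing R] [Finite σ] (C : Set σ) :
    (Ideal.span (X '' C : Set (MvPolynomial σ R))).height = C.encard := by
  have hprime (C : Set σ) := isPrime_span_X_image (R := R) C
  apply le_antisymm
  · refine (Ideal.height_le_spanFinrank _ (hprime C).ne_top).trans ?_
    rw [← C.toFinite.cast_ncard_eq, Nat.cast_le]
    exact (Submodule.spanFinrank_span_le_ncard_of_finite (Set.toFinite _)).trans
      (Set.ncard_image_le C.toFinite)
  · induction C, C.toFinite using Set.Finite.induction_on with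
    | empty => simp
    | @insert x C hx _ ih =>
      have := hprime C
      have hlt := span_X_image_strictMono (R := R) (Set.ssubset_insert hx)
      rw [Set.encard_insert_of_notMem hx]
      exact (add_le_add_left ih 1).trans
        (Order.add_one_le_of_lt (Ideal.height_strict_mono_of_isPrime_of_isPrime hlt))

theorem mem_associatedPrimes_quotient_iff [IsNoetherianRing R] {I P : Ideal R} :
    P ∈ associatedPrimes R (R ⧸ I) ↔ P.IsPrime ∧ ∃ f, ∀ r, r ∈ P ↔ r * f ∈ I := by
  refine Iff.trans (isAssociatedPrime_iff (I := P) (M := R ⧸ I)) (and_congr_right fun _ => ?_)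
  have hcolon (f r : R) : r ∈ (⊥ : Submodule R (R ⧸ I)).colon {Ideal.Quotient.mk I f} ↔
      r * f ∈ I := by
    rw [Submodule.mem_colon_singleton, Submodule.mem_bot, ← Ideal.Quotient.eq_zero_iff_mem]
    rfl
  constructor
  · rintro ⟨x, rfl⟩
    obtain ⟨f, rfl⟩ := Ideal.Quotient.mk_surjective x
    exact ⟨f, hcolon f⟩
  · rintro ⟨f, hf⟩
    exact ⟨Ideal.Quotient.mk I f, Ideal.ext fun r => (hf r).trans (hcolon f r).symm⟩

/-- For the ideal `I` generated by the monomials with exponents in `S`, this is the equality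
`I : X ^ m = (X x | x ∈ C)`, expressed through exponents. -/
def IsColonExponent (S : Set (σ →₀ ℕ)) (C : Set σ) (m : σ →₀ ℕ) : Prop :=
  ∀ b : σ →₀ ℕ, (∃ s ∈ S, s ≤ b + m) ↔ ∃ x ∈ C, b x ≠ 0

variable {S : Set (σ →₀ ℕ)} {C : Set σ} {m : σ →₀ ℕ}

theorem IsColonExponent.mul_monomial_mem_iff (h : IsColonExponent S C m) (f : MvPolynomial σ R) :
    f * monomial m 1 ∈ Ideal.span ((fun s => monomial s (1 : R)) '' S) ↔
      f ∈ Ideal.span (X '' C : Set (MvPolynomial σ R)) := by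
  rw [mem_ideal_span_monomial_image, mem_ideal_span_X_image]
  constructor
  · intro hf b hb
    exact (h b).1 (hf (b + m) (by simpa [mem_support_iff, coeff_mul_monomial] using hb))
  · intro hf e he
    rw [mem_support_iff, coeff_mul_monomial', mul_one] at he
    obtain ⟨hme, he⟩ := ite_ne_right_iff.1 he
    simpa only [tsub_add_cancel_of_le hme] using (h (e - m)).2 (hf _ (mem_support_iff.2 he))

theorem exists_X_mem_of_monomial_mem {P : Ideal (MvPolynomial σ R)} (hP : P.IsPrime)
    (hm : monomial m 1 ∈ P) : ∃ x, m x ≠ 0 ∧ X x ∈ P := by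
  rw [monomial_eq, C_1, one_mul, Finsupp.prod, hP.prod_mem_iff] at hm
  obtain ⟨x, hx, hxP⟩ := hm
  exact ⟨x, Finsupp.mem_support_iff.1 hx, hP.mem_of_pow_mem _ hxP⟩

theorem mem_span_X_image_of_mul_mem [IsDomain R] {f g : MvPolynomial σ R} (hf : f ≠ 0)
    (hC : ∀ x ∈ C, X x * f ∈ Ideal.span ((fun s => monomial s (1 : R)) '' S))
    (hS : ∀ m ∈ f.support, ∀ b : σ →₀ ℕ, (∀ x ∈ C, b x = 0) → ∀ s ∈ S, ¬ s ≤ b + m)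
    (hg : g * f ∈ Ideal.span ((fun s => monomial s (1 : R)) '' S)) :
    g ∈ Ideal.span (X '' C) := by
  classical
  set I := Ideal.span ((fun s => monomial s (1 : R)) '' S)
  obtain ⟨g₀, g₁, rfl, hg₀, hg₁⟩ := exists_add_eq_of_exponents (fun b => ∀ x ∈ C, b x = 0) g
  have hg₁C : g₁ ∈ Ideal.span (X '' C) := mem_ideal_span_X_image.2 fun b hb => by
    simpa only [not_forall, exists_prop] using hg₁ b hb
  have hCI : Ideal.span (X '' C) ≤ I.colon {f} := by
    rw [Ideal.span_le]
    rintro _ ⟨x, hx, rfl⟩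
    exact Submodule.mem_colon_singleton.2 (hC x hx)
  have hg₀I : g₀ * f ∈ I := by
    rw [add_mul] at hg
    exact (I.add_mem_iff_left (Submodule.mem_colon_singleton.1 (hCI hg₁C))).1 hg
  have hg₀f : g₀ * f = 0 := by
    by_contra hne
    obtain ⟨e, he⟩ := support_nonempty.mpr hne
    obtain ⟨s, hs, hse⟩ := mem_ideal_span_monomial_image.1 hg₀I e he
    obtain ⟨b, hb, m, hm, rfl⟩ := Finset.mem_add.1 (support_mul _ _ he)
    exact hS m hm b (hg₀ b hb).2 s hs hse
  rwa [(mul_eq_zero.1 hg₀f).resolve_right hf, zero_add]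

/-- Multiplying a polynomial that witnesses the associated prime by a high power of each variable
outside the prime and then dropping the terms in the ideal keeps it a witness. -/
theorem exists_witness_of_mem_associatedPrimes [Finite σ] [IsNoetherianRing R] {N : σ →₀ ℕ}
    {P : Ideal (MvPolynomial σ R)}
    (hP : P ∈ associatedPrimes (MvPolynomial σ R)
      (MvPolynomial σ R ⧸ Ideal.span ((fun s => monomial s (1 : R)) '' S))) :
    ∃ f, (∀ r, r ∈ P ↔ r * f ∈ Ideal.span ((fun s => monomial s (1 : R)) '' S)) ∧
      ∀ m ∈ f.support, (∀ s ∈ S, ¬ s ≤ m) ∧ ∀ x, X x ∉ P → N x ≤ m x := by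
  classical
  set I := Ideal.span ((fun s => monomial s (1 : R)) '' S)
  obtain ⟨hprime, f, hf⟩ := mem_associatedPrimes_quotient_iff.1 hP
  let e : σ →₀ ℕ := Finsupp.equivFunOnFinite.symm fun x => if X x ∈ P then 0 else N x
  have he (x : σ) : e x = if X x ∈ P then 0 else N x := rfl
  have heP : monomial e (1 : R) ∉ P := fun h => by
    obtain ⟨x, hx, hxP⟩ := exists_X_mem_of_monomial_mem hprime h
    exact hx (by rw [he, if_pos hxP])
  obtain ⟨f₀, f₁, hadd, hf₀, hf₁⟩ :=
    exists_add_eq_of_exponents (fun m => ∀ s ∈ S, ¬ s ≤ m) (monomial e 1 * f)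
  have hf₁I : f₁ ∈ I := mem_ideal_span_monomial_image.2 fun m hm => by
    simpa only [not_forall, not_not, exists_prop] using hf₁ m hm
  refine ⟨f₀, fun r => ?_, fun m hm => ⟨(hf₀ m hm).2, fun x hx => ?_⟩⟩
  · have hef : r ∈ P ↔ r * (monomial e 1 * f) ∈ I := by
      rw [← mul_assoc, ← hf]
      exact ⟨fun h => P.mul_mem_right _ h, fun h => (hprime.mem_or_mem h).resolve_right heP⟩
    rw [hef, ← hadd, mul_add, Ideal.add_mem_iff_left _ (I.mul_mem_left _ hf₁I)]
  · have hem := (hf₀ m hm).1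
    rw [mem_support_iff, coeff_monomial_mul'] at hem
    simpa only [he, if_neg hx] using (ite_ne_right_iff.1 hem).1 x

theorem exists_isColonExponent_of_mem_associatedPrimes [Finite σ] [IsDomain R]
    [IsNoetherianRing R] (hS : BddAbove S) {P : Ideal (MvPolynomial σ R)}
    (hP : P ∈ associatedPrimes (MvPolynomial σ R)
      (MvPolynomial σ R ⧸ Ideal.span ((fun s => monomial s (1 : R)) '' S))) :
    ∃ C m, P = Ideal.span (X '' C) ∧ IsColonExponent S C m := by
  obtain ⟨N, hN⟩ := hS
  obtain ⟨f, hf, hsupp⟩ := exists_witness_of_mem_associatedPrimes (N := N) hP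
  have hprime := (mem_associatedPrimes_quotient_iff.1 hP).1
  have hf0 : f ≠ 0 := by
    rintro rfl
    exact hprime.one_notMem ((hf 1).2 (by simp))
  set C : Set σ := {x | X x ∈ P}
  have hsmall {m : σ →₀ ℕ} (hm : m ∈ f.support) (b : σ →₀ ℕ) (hb : ∀ x ∈ C, b x = 0) :
      ∀ s ∈ S, ¬ s ≤ b + m := by
    refine fun s hs hle => (hsupp m hm).1 s hs fun x => ?_
    by_cases hx : x ∈ C
    · simpa [hb x hx] using hle x
    · exact (hN hs x).trans ((hsupp m hm).2 x hx)
  have hCP : Ideal.span (X '' C) ≤ P := by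
    rw [Ideal.span_le]
    rintro _ ⟨x, hx, rfl⟩
    exact hx
  have hPC : P ≤ Ideal.span (X '' C) := fun g hg =>
    mem_span_X_image_of_mul_mem hf0 (fun x hx => (hf _).1 hx) (fun m => hsmall) ((hf g).1 hg)
  obtain ⟨m, hm⟩ := support_nonempty.mpr hf0
  refine ⟨C, m, hPC.antisymm hCP, fun b => ⟨fun ⟨s, hs, hle⟩ => ?_, fun ⟨x, hxC, hx⟩ => ?_⟩⟩
  · by_contra! hb
    exact hsmall hm b hb s hs hle
  · have hxf : Finsupp.single x 1 + m ∈ (X x * f).support := by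
      rw [mem_support_iff, coeff_X_mul]
      exact mem_support_iff.1 hm
    obtain ⟨s, hs, hle⟩ := mem_ideal_span_monomial_image.1 ((hf _).1 hxC) _ hxf
    refine ⟨s, hs, hle.trans (add_le_add_left ?_ m)⟩
    rwa [Finsupp.single_le_iff, Nat.one_le_iff_ne_zero]

theorem mem_associatedPrimes_span_monomial_iff [Finite σ] [IsDomain R] [IsNoetherianRing R]
    (hS : BddAbove S) {P : Ideal (MvPolynomial σ R)} :
    P ∈ associatedPrimes (MvPolynomial σ R)
        (MvPolynomial σ R ⧸ Ideal.span ((fun s => monomial s (1 : R)) '' S)) ↔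
      ∃ C m, P = Ideal.span (X '' C) ∧ IsColonExponent S C m := by
  refine ⟨exists_isColonExponent_of_mem_associatedPrimes hS, ?_⟩
  rintro ⟨C, m, rfl, hm⟩
  exact mem_associatedPrimes_quotient_iff.2
    ⟨isPrime_span_X_image C, monomial m 1, fun r => (hm.mul_monomial_mem_iff r).symm⟩

end MonomialIdeals

namespace WeightedOrientedGraph

open MvPolynomial

variable {V : Type*} {D : WeightedOrientedGraph V}

theorem adj_of_arc {x y : V} (h : D.arc x y) : D.G.Adj x y := (D.adj_iff x y).2 (Or.inl h)

theorem arc_ne {x y : V} (h : D.arc x y) : x ≠ y := (adj_of_arc h).ne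

variable (D) in
/-- The vertices of weight greater than one all of whose arcs end in `C`. They are the vertices
whose arcs can justify the members of a strong cover without neighbours outside the cover. -/
def supporters (C : Set V) : Set V := {y ∈ D.heavy | ∀ z, D.arc y z → z ∈ C}

variable (D) in
/-- A strong vertex cover: a vertex cover `C` in which every vertex without neighbours outside `C`
receives an arc from a supporter. These are the covers whose variables generate the associated
primes of the edge ideal. The supporter lies in `C` as well, being a neighbour of such a vertex. -/
def IsStrongCover (C : Set V) : Prop :=
  D.G.IsVertexCover C ∧ ∀ x ∈ C, (∀ y, D.G.Adj x y → y ∈ C) → ∃ y ∈ D.supporters C, D.arc y x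

variable (D) in
/-- The exponents of the generators `x * y ^ w(y)` of the edge ideal. -/
def edgeExponents : Set (V →₀ ℕ) :=
  {s | ∃ x y, D.arc x y ∧ s = Finsupp.single x 1 + Finsupp.single y (D.w y)}

theorem edgeIdeal_eq_span_monomial (K : Type*) [Field K] :
    D.edgeIdeal K = Ideal.span ((fun s => monomial s (1 : K)) '' D.edgeExponents) := by
  have hmon (x y : V) : (X x * X y ^ D.w y : MvPolynomial V K) =
      monomial (Finsupp.single x 1 + Finsupp.single y (D.w y)) 1 := by
    rw [X_pow_eq_monomial, X, monomial_mul, one_mul]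
  rw [edgeIdeal]
  congr 1
  ext f
  constructor
  · rintro ⟨x, y, h, rfl⟩
    exact ⟨_, ⟨x, y, h, rfl⟩, (hmon x y).symm⟩
  · rintro ⟨_, ⟨x, y, h, rfl⟩, rfl⟩
    exact ⟨x, y, h, (hmon x y).symm⟩

theorem exists_mem_edgeExponents_le_iff {m : V →₀ ℕ} :
    (∃ s ∈ D.edgeExponents, s ≤ m) ↔ ∃ x y, D.arc x y ∧ 1 ≤ m x ∧ D.w y ≤ m y := by
  classical
  constructor
  · rintro ⟨_, ⟨x, y, h, rfl⟩, hle⟩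
    have hne := arc_ne h
    refine ⟨x, y, h, ?_, ?_⟩
    · simpa [Finsupp.single_apply, hne.symm] using hle x
    · simpa [Finsupp.single_apply, hne] using hle y
  · rintro ⟨x, y, h, hx, hy⟩
    have hne := arc_ne h
    refine ⟨_, ⟨x, y, h, rfl⟩, fun z => ?_⟩
    simp only [Finsupp.add_apply, Finsupp.single_apply]
    grind

theorem bddAbove_edgeExponents [Finite V] : BddAbove D.edgeExponents := by
  refine (Set.Finite.subset (Set.finite_range fun e : V × V =>
    Finsupp.single e.1 1 + Finsupp.single e.2 (D.w e.2)) ?_).bddAbove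
  rintro _ ⟨x, y, -, rfl⟩
  exact ⟨(x, y), rfl⟩

variable {C : Set V}

theorem IsStrongCover.exists_arc_of_forall_arc_mem (hC : D.IsStrongCover C) {x : V} (hx : x ∈ C)
    (hout : ∀ z, D.arc x z → z ∈ C) : ∃ y, D.arc y x ∧ (y ∉ C ∨ y ∈ C ∧ y ∈ D.supporters C) := by
  by_cases hin : ∃ y, D.arc y x ∧ y ∉ C
  · exact hin.imp fun _ h => ⟨h.1, Or.inl h.2⟩
  · have hN (y : V) (hxy : D.G.Adj x y) : y ∈ C :=
      ((D.adj_iff x y).1 hxy).elim (hout y) fun h => by_contra fun hy => hin ⟨y, h, hy⟩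
    obtain ⟨y, hy, hyx⟩ := hC.2 x hx hN
    exact ⟨y, hyx, Or.inr ⟨hN y (adj_of_arc hyx).symm, hy⟩⟩

theorem IsStrongCover.exists_isColonExponent [Finite V] (hC : D.IsStrongCover C) :
    ∃ m, IsColonExponent D.edgeExponents C m := by
  classical
  let m : V →₀ ℕ := Finsupp.equivFunOnFinite.symm fun x =>
    if x ∉ C then D.w x else if ∀ z, D.arc x z → z ∈ C then D.w x - 1 else 0
  have hm (x : V) : m x =
    if x ∉ C then D.w x else if ∀ z, D.arc x z → z ∈ C then D.w x - 1 else 0 := rfl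
  refine ⟨m, fun b => exists_mem_edgeExponents_le_iff.trans ⟨?_, ?_⟩⟩
  · rintro ⟨x, y, hxy, hx, hy⟩
    by_contra! hb
    have hw := D.one_le_w y
    rw [Finsupp.add_apply, hm] at hx hy
    by_cases hyC : y ∈ C
    · rw [hb y hyC, if_neg (not_not.2 hyC)] at hy
      split_ifs at hy <;> omega
    · have hxC : x ∈ C := (hC.1 (adj_of_arc hxy)).resolve_right hyC
      rw [hb x hxC, if_neg (not_not.2 hxC), if_neg fun h => hyC (h y hxy)] at hx
      omega
  · rintro ⟨x, hxC, hx⟩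
    simp only [Finsupp.add_apply]
    have hout {y : V} (hy : y ∉ C) : m y = D.w y := by rw [hm, if_pos hy]
    by_cases hxout : ∀ z, D.arc x z → z ∈ C
    · have hmx : m x = D.w x - 1 := by rw [hm, if_neg (not_not.2 hxC), if_pos hxout]
      obtain ⟨y, hyx, hy⟩ : ∃ y, D.arc y x ∧ 1 ≤ m y := by
        obtain ⟨y, hyx, hyC | ⟨hyC, hwy, hyout⟩⟩ := hC.exists_arc_of_forall_arc_mem hxC hxout
        · exact ⟨y, hyx, hout hyC ▸ D.one_le_w y⟩
        · refine ⟨y, hyx, ?_⟩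
          rw [hm, if_neg (not_not.2 hyC), if_pos hyout]
          exact Nat.le_sub_one_of_lt hwy
      exact ⟨y, x, hyx, by omega, by omega⟩
    · push Not at hxout
      obtain ⟨z, hxz, hzC⟩ := hxout
      exact ⟨x, z, hxz, by omega, by rw [hout hzC]; omega⟩

section ColonExponent

variable {m : V →₀ ℕ} (h : IsColonExponent D.edgeExponents C m)

include h

theorem exists_mem_ne_zero_of_isColonExponent {b : V →₀ ℕ} {x y : V} (hxy : D.arc x y)
    (hx : 1 ≤ b x + m x) (hy : D.w y ≤ b y + m y) : ∃ z ∈ C, b z ≠ 0 :=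
  (h b).1 (exists_mem_edgeExponents_le_iff.2 ⟨x, y, hxy, hx, hy⟩)

theorem not_arc_of_isColonExponent {x y : V} (hx : 1 ≤ m x) (hy : D.w y ≤ m y) : ¬ D.arc x y :=
  fun hxy => by
    obtain ⟨z, -, hz⟩ := exists_mem_ne_zero_of_isColonExponent h (b := 0) hxy
      (by simpa using hx) (by simpa using hy)
    exact hz rfl

theorem exists_arc_of_isColonExponent {x : V} (hx : x ∈ C) :
    ∃ y z, D.arc y z ∧ (1 ≤ m y ∨ y = x) ∧ (D.w z ≤ m z ∨ z = x) := by
  classical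
  obtain ⟨y, z, hyz, hy, hz⟩ :=
    exists_mem_edgeExponents_le_iff.1 ((h (Finsupp.single x 1)).2 ⟨x, hx, by simp⟩)
  refine ⟨y, z, hyz, or_iff_not_imp_right.2 fun hyx => ?_, or_iff_not_imp_right.2 fun hzx => ?_⟩
  · simpa [Ne.symm hyx] using hy
  · simpa [Ne.symm hzx] using hz

theorem lt_weight_of_isColonExponent {x : V} (hx : x ∈ C) (hmx : 1 ≤ m x) : m x < D.w x := by
  by_contra! hwx
  obtain ⟨y, z, hyz, hy, hz⟩ := exists_arc_of_isColonExponent h hx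
  exact not_arc_of_isColonExponent h (hy.elim id fun e => e ▸ hmx) (hz.elim id fun e => e ▸ hwx) hyz

theorem isVertexCover_of_isColonExponent : D.G.IsVertexCover C := by
  classical
  have harc {x y : V} (hxy : D.arc x y) : x ∈ C ∨ y ∈ C := by
    by_contra! hC
    obtain ⟨z, hz, hbz⟩ := exists_mem_ne_zero_of_isColonExponent h
      (b := Finsupp.single x 1 + Finsupp.single y (D.w y)) hxy (by simp; omega) (by simp; omega)
    have hzx : z ≠ x := fun e => hC.1 (e ▸ hz)
    have hzy : z ≠ y := fun e => hC.2 (e ▸ hz)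
    exact hbz (by simp [hzx.symm, hzy.symm])
  exact fun x y hxy => ((D.adj_iff x y).1 hxy).elim harc fun hyx => (harc hyx).symm

theorem isStrongCover_of_isColonExponent : D.IsStrongCover C := by
  classical
  refine ⟨isVertexCover_of_isColonExponent h, fun x hxC hxN => ?_⟩
  obtain ⟨y, z, hyz, hy, hz⟩ := exists_arc_of_isColonExponent h hxC
  obtain rfl | hzx := eq_or_ne z x
  · have hmy : 1 ≤ m y := hy.resolve_right (arc_ne hyz)
    have hyC : y ∈ C := hxN y (adj_of_arc hyz).symm
    refine ⟨y, ⟨hmy.trans_lt (lt_weight_of_isColonExponent h hyC hmy), fun t hyt => ?_⟩, hyz⟩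
    by_contra htC
    obtain ⟨s, hs, hbs⟩ := exists_mem_ne_zero_of_isColonExponent h
      (b := Finsupp.single t (D.w t)) hyt (by omega) (by simp)
    have hst : s ≠ t := fun e => htC (e ▸ hs)
    exact hbs (by simp [hst.symm])
  · have hmz := hz.resolve_right hzx
    obtain rfl : y = x :=
      hy.resolve_left fun hmy => not_arc_of_isColonExponent h hmy hmz hyz
    have hlt := lt_weight_of_isColonExponent h (hxN z (adj_of_arc hyz))
      ((D.one_le_w z).trans hmz)
    exact absurd hmz hlt.not_ge

end ColonExponent

theorem mem_associatedPrimes_edgeIdeal_iff [Finite V] (K : Type*) [Field K]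
    {P : Ideal (MvPolynomial V K)} :
    P ∈ associatedPrimes (MvPolynomial V K) (MvPolynomial V K ⧸ D.edgeIdeal K) ↔
      ∃ C, D.IsStrongCover C ∧ P = Ideal.span (X '' C) := by
  rw [edgeIdeal_eq_span_monomial, mem_associatedPrimes_span_monomial_iff bddAbove_edgeExponents]
  constructor
  · rintro ⟨C, m, hP, hm⟩
    exact ⟨C, isStrongCover_of_isColonExponent hm, hP⟩
  · rintro ⟨C, hC, hP⟩
    obtain ⟨m, hm⟩ := hC.exists_isColonExponent
    exact ⟨C, m, hP, hm⟩

theorem isUnmixedIdeal_edgeIdeal_iff [Finite V] (K : Type*) [Field K] :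
    (D.edgeIdeal K).IsUnmixedIdeal ↔
      ∀ C C', D.IsStrongCover C → D.IsStrongCover C' → C.encard = C'.encard := by
  simp only [Ideal.IsUnmixedIdeal, mem_associatedPrimes_edgeIdeal_iff]
  constructor
  · intro h C C' hC hC'
    simpa only [height_span_X_image] using h _ ⟨C, hC, rfl⟩ _ ⟨C', hC', rfl⟩
  · rintro h _ ⟨C, hC, rfl⟩ _ ⟨C', hC', rfl⟩
    simpa only [height_span_X_image] using h C C' hC hC'

end WeightedOrientedGraph

theorem isVertexCover_sdiff_singleton {V : Type*} {G : SimpleGraph V} {C : Set V} {x : V}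
    (hC : G.IsVertexCover C) (hx : ∀ y, G.Adj x y → y ∈ C) : G.IsVertexCover (C \ {x}) := by
  intro a b hab
  obtain rfl | hax := eq_or_ne a x
  · exact Or.inr ⟨hx b hab, hab.ne'⟩
  obtain rfl | hbx := eq_or_ne b x
  · exact Or.inl ⟨hx a hab.symm, hax⟩
  exact (hC hab).imp (fun h => ⟨h, hax⟩) fun h => ⟨h, hbx⟩

namespace WeightedOrientedGraph

variable {V : Type*} {D : WeightedOrientedGraph V}

theorem exists_isStrongCover_of_isIndepSet [Finite V] {S P W : Set V} (hW : D.G.IsIndepSet W)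
    (hP : P ⊆ D.heavy) (hSW : Disjoint S W) (hPW : ∀ x ∈ P, ∀ y ∈ W, ¬ D.arc x y)
    (hS : ∀ x ∈ S, (∃ y ∈ W, D.G.Adj x y) ∨ ∃ y ∈ P, D.arc y x) :
    ∃ C, D.IsStrongCover C ∧ S ⊆ C := by
  let A : Set V := S ∪ {z | ∃ x ∈ P, D.arc x z}
  have hstart : D.G.IsVertexCover Wᶜ ∧ A ⊆ Wᶜ := by
    refine ⟨SimpleGraph.isVertexCover_compl.2 hW, ?_⟩
    rintro z (hz | ⟨x, hx, hxz⟩) hzW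
    · exact Set.disjoint_left.1 hSW hz hzW
    · exact hPW x hx z hzW hxz
  obtain ⟨C, hCW, ⟨hcov, hAC⟩, hmin⟩ := exists_minimal_le_of_wellFoundedLT
    (fun C : Set V => D.G.IsVertexCover C ∧ A ⊆ C) Wᶜ hstart
  refine ⟨C, ⟨hcov, fun x hxC hxN => ?_⟩, Set.subset_union_left.trans hAC⟩
  suffices h : ∃ y ∈ P, D.arc y x by
    obtain ⟨y, hy, hyx⟩ := h
    exact ⟨y, ⟨hP hy, fun z hyz => hAC (Or.inr ⟨y, hy, hyz⟩)⟩, hyx⟩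
  have hxA : x ∈ A := by
    by_contra hxA
    exact (hmin ⟨isVertexCover_sdiff_singleton hcov hxN,
      fun a ha => ⟨hAC ha, fun h => hxA (h ▸ ha)⟩⟩ Set.sdiff_subset hxC).2 rfl
  rcases hxA with hxS | hx
  · exact (hS x hxS).resolve_left fun ⟨y, hyW, hxy⟩ => hCW (hxN y hxy) hyW
  · exact hx

variable (D) in
/-- The oriented edges of a subgraph. -/
def arcIn (H : D.G.Subgraph) (x y : V) : Prop := H.Adj x y ∧ D.arc x y

theorem reflTransGen_arcIn_of_hasOrientedPath {H : D.G.Subgraph} {x y : V}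
    (h : D.HasOrientedPath H x y) : Relation.ReflTransGen (D.arcIn H) x y := by
  obtain ⟨p, -, hor, hle⟩ := h
  induction p with
  | nil => exact Relation.ReflTransGen.refl
  | @cons a b c hab p ih =>
    rw [SimpleGraph.Walk.toSubgraph, sup_le_iff] at hle
    refine Relation.ReflTransGen.head (b := b) ⟨hle.1.2 (by simp), ?_⟩ (ih ?_ hle.2)
    · exact hor ⟨(a, b), hab⟩ (by simp)
    · exact fun d hd => hor d (by simp [hd])

theorem hasOrientedPath_of_reflTransGen_arcIn {H : D.G.Subgraph} {x y : V} (hx : x ∈ H.verts)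
    (h : Relation.ReflTransGen (D.arcIn H) x y) : D.HasOrientedPath H x y := by
  classical
  obtain ⟨p, hor, hle⟩ : ∃ p : D.G.Walk x y, D.IsOriented p ∧ p.toSubgraph ≤ H := by
    induction h using Relation.ReflTransGen.head_induction_on with
    | refl =>
      exact ⟨SimpleGraph.Walk.nil, by simp [IsOriented], by simpa [SimpleGraph.Walk.toSubgraph]⟩
    | @head a b hab _ ih =>
      obtain ⟨p, hor, hle⟩ := ih (H.edge_vert hab.1.symm)
      refine ⟨SimpleGraph.Walk.cons (H.adj_sub hab.1) p, fun d hd => ?_,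
        sup_le (SimpleGraph.subgraphOfAdj_le_of_adj H hab.1) hle⟩
      rw [SimpleGraph.Walk.darts_cons, List.mem_cons] at hd
      rcases hd with rfl | hd
      · exact hab.2
      · exact hor d hd
  exact ⟨p.bypass, p.bypass_isPath, fun d hd => hor d (p.darts_bypass_subset_darts hd),
    SimpleGraph.Walk.toSubgraph_bypass_le_toSubgraph.trans hle⟩

theorem IsOrientedCycle.exists_arcIn {C : D.G.Subgraph} (h : D.IsOrientedCycle C) {x : V}
    (hx : x ∈ C.verts) : ∃ y, D.arcIn C y x := by
  classical
  obtain ⟨c, p, hp, hor, rfl⟩ := h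
  rw [SimpleGraph.Walk.mem_verts_toSubgraph] at hx
  have hor' : D.IsOriented (p.rotate x hx) := fun d hd =>
    hor d ((p.rotate_darts x hx).mem_iff.1 hd)
  have hnil := (hp.rotate hx).not_nil
  rw [← SimpleGraph.Walk.toSubgraph_rotate p hx]
  exact ⟨_, SimpleGraph.Walk.toSubgraph_adj_penultimate _ hnil,
    hor' _ (SimpleGraph.Walk.lastDart_mem_darts hnil)⟩

section Degrees

variable [Finite V]

theorem one_le_deg_of_adj {H : D.G.Subgraph} {x y : V} (h : H.Adj x y) : 1 ≤ D.deg H x :=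
  (Set.ncard_pos (Set.toFinite _)).2 ⟨y, h⟩

theorem two_le_deg_of_arcIn {H : D.G.Subgraph} {x y z : V} (hxy : D.arcIn H x y)
    (hyz : D.arcIn H y z) : 2 ≤ D.deg H y := by
  refine (Set.one_lt_ncard_iff (Set.toFinite _)).2 ⟨x, z, hxy.1.symm, hyz.1, ?_⟩
  rintro rfl
  exact D.arc_asymm _ _ hxy.2 hyz.2

theorem deg_of_verts_eq_singleton {T : D.G.Subgraph} {v : V} (h : T.verts = {v}) :
    D.deg T v = 0 := by
  rw [deg, Set.ncard_eq_zero (Set.toFinite _), Set.eq_empty_iff_forall_notMem]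
  intro y hy
  have hyT : y ∈ T.verts := T.edge_vert hy.symm
  rw [h, Set.mem_singleton_iff] at hyT
  exact T.loopless.irrefl _ (hyT ▸ hy : T.Adj v v)

end Degrees

theorem deg_iSup_of_mem {ι : Type*} {F : ι → D.G.Subgraph}
    (hF : Pairwise (Function.onFun Disjoint fun i => (F i).verts)) {i : ι} {x : V}
    (hx : x ∈ (F i).verts) : D.deg (⨆ i, F i) x = D.deg (F i) x := by
  have hnbr : (⨆ i, F i).neighborSet x = (F i).neighborSet x := by
    ext y
    simp only [SimpleGraph.Subgraph.mem_neighborSet, SimpleGraph.Subgraph.iSup_adj]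
    refine ⟨fun ⟨j, hj⟩ => ?_, fun h => ⟨i, h⟩⟩
    obtain rfl : i = j := hF.eq (Set.not_disjoint_iff.2 ⟨x, hx, (F j).edge_vert hj⟩)
    exact hj
  rw [deg, deg, hnbr]

theorem IsROT.inner_subset_heavy [Finite V] {T : D.G.Subgraph} {v : V} (hT : D.IsROT T v) :
    D.inner T ![v] ⊆ D.heavy := by
  intro x hx
  by_contra hw
  have hw1 : D.w x = 1 := le_antisymm (not_lt.1 hw) (D.one_le_w x)
  have hinner : x ∈ T.verts ∧ (2 ≤ D.deg T x ∨ x = v ∧ D.deg T x = 1) := by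
    rcases hx with ⟨hxT, hdeg⟩ | ⟨i, rfl, hdeg⟩
    · exact ⟨hxT, Or.inl hdeg⟩
    · obtain rfl : i = 0 := Subsingleton.elim _ _
      exact ⟨hT.1, Or.inr ⟨rfl, hdeg⟩⟩
  obtain ⟨hxT, hdeg⟩ := hinner
  rcases hT.2.2.2 x hxT hw1 with ⟨hdeg1, hxv⟩ | ⟨hverts, rfl⟩
  · rcases hdeg with hdeg | ⟨rfl, -⟩
    · omega
    · exact hxv rfl
  · have := deg_of_verts_eq_singleton hverts
    omega

theorem IsROT.exists_inner_arc [Finite V] {T : D.G.Subgraph} {v x : V} (hT : D.IsROT T v)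
    (hx : x ∈ T.verts) (hxv : x ≠ v) : ∃ y ∈ D.inner T ![v], D.arc y x := by
  obtain rfl | ⟨y, hvy, hyx⟩ := Relation.ReflTransGen.cases_tail
    (reflTransGen_arcIn_of_hasOrientedPath (hT.2.2.1 x ⟨hx, hxv⟩))
  · exact (hxv rfl).elim
  refine ⟨y, ?_, hyx.2⟩
  obtain rfl | ⟨z, -, hzy⟩ := Relation.ReflTransGen.cases_tail hvy
  · rcases (one_le_deg_of_adj hyx.1).eq_or_lt with hdeg | hdeg
    · exact Or.inr ⟨0, rfl, hdeg.symm⟩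
    · exact Or.inl ⟨hT.1, hdeg⟩
  · exact Or.inl ⟨T.edge_vert hyx.1, two_le_deg_of_arcIn hzy hyx⟩

theorem IsUnicycle.inner_subset_heavy {B : D.G.Subgraph} (hB : D.IsUnicycle B) :
    D.inner B ![] ⊆ D.heavy := by
  obtain ⟨C, -, -, -, hw⟩ := hB
  rintro x (⟨hxB, hdeg⟩ | ⟨i, -⟩)
  · by_contra hx
    have := hw x hxB (le_antisymm (not_lt.1 hx) (D.one_le_w x))
    omega
  · exact i.elim0

theorem IsUnicycle.exists_inner_arc [Finite V] {B : D.G.Subgraph} (hB : D.IsUnicycle B) {x : V}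
    (hx : x ∈ B.verts) : ∃ y ∈ D.inner B ![], D.arc y x := by
  obtain ⟨C, hC, hcycle, hreach, -⟩ := hB
  have hCB : C ≤ B := (hC.ge rfl : C ∈ D.cycles B).1
  have hmono {y z : V} (h : D.arcIn C y z) : D.arcIn B y z := ⟨hCB.2 h.1, h.2⟩
  have hpred {y : V} (hy : y ∈ B.verts) :
      ∃ z, D.arcIn B z y := by
    by_cases hyC : y ∈ C.verts
    · obtain ⟨z, hzy⟩ := hcycle.exists_arcIn hyC
      exact ⟨z, hmono hzy⟩
    · obtain ⟨c, hc, hcy⟩ := hreach y ⟨hy, hyC⟩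
      obtain rfl | ⟨z, -, hzy⟩ :=
        Relation.ReflTransGen.cases_tail (reflTransGen_arcIn_of_hasOrientedPath hcy)
      · exact (hyC hc).elim
      · exact ⟨z, hzy⟩
  obtain ⟨y, hyx⟩ := hpred hx
  have hyB := B.edge_vert hyx.1
  obtain ⟨z, hzy⟩ := hpred hyB
  exact ⟨y, Or.inl ⟨hyB, two_le_deg_of_arcIn hzy hyx⟩, hyx.2⟩

theorem inner_iSup_sup_iSup {r t : ℕ} {T : Fin r → D.G.Subgraph} {v : Fin r → V}
    {B : Fin t → D.G.Subgraph} (hv : ∀ i, v i ∈ (T i).verts)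
    (hTT : ∀ i i', i ≠ i' → Disjoint (T i).verts (T i').verts)
    (hBB : ∀ j j', j ≠ j' → Disjoint (B j).verts (B j').verts)
    (hTB : ∀ i j, Disjoint (T i).verts (B j).verts) :
    D.inner ((⨆ i, T i) ⊔ ⨆ j, B j) v =
      (⋃ i, D.inner (T i) ![v i]) ∪ ⋃ j, D.inner (B j) ![] := by
  have hdisj : Pairwise (Function.onFun Disjoint fun k => (Sum.elim T B k).verts) := by
    rintro (i | j) (i' | j') hne
    · exact hTT i i' (ne_of_apply_ne Sum.inl hne)
    · exact hTB i j'
    · exact (hTB i' j).symm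
    · exact hBB j j' (ne_of_apply_ne Sum.inr hne)
  have hsup : (⨆ i, T i) ⊔ ⨆ j, B j = ⨆ k, Sum.elim T B k := by
    rw [iSup_sum]
    rfl
  have hdegT {i : Fin r} {x : V} (hx : x ∈ (T i).verts) :
      D.deg ((⨆ i, T i) ⊔ ⨆ j, B j) x = D.deg (T i) x :=
    hsup ▸ deg_iSup_of_mem hdisj (i := Sum.inl i) hx
  have hdegB {j : Fin t} {x : V} (hx : x ∈ (B j).verts) :
      D.deg ((⨆ i, T i) ⊔ ⨆ j, B j) x = D.deg (B j) x :=
    hsup ▸ deg_iSup_of_mem hdisj (i := Sum.inr j) hx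
  ext x
  simp only [inner, Set.mem_union, Set.mem_iUnion, Set.mem_ofPred_eq,
    SimpleGraph.Subgraph.verts_sup, SimpleGraph.Subgraph.verts_iSup, Fin.exists_fin_one,
    Matrix.cons_val_fin_one, IsEmpty.exists_iff, or_false]
  constructor
  · rintro (⟨⟨i, hi⟩ | ⟨j, hj⟩, hdeg⟩ | ⟨i, rfl, hdeg⟩)
    · exact Or.inl ⟨i, Or.inl ⟨hi, hdegT hi ▸ hdeg⟩⟩
    · exact Or.inr ⟨j, hj, hdegB hj ▸ hdeg⟩
    · exact Or.inl ⟨i, Or.inr ⟨rfl, hdegT (hv i) ▸ hdeg⟩⟩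
  · rintro (⟨i, ⟨hi, hdeg⟩ | ⟨rfl, hdeg⟩⟩ | ⟨j, hj, hdeg⟩)
    · exact Or.inl ⟨Or.inl ⟨i, hi⟩, (hdegT hi).symm ▸ hdeg⟩
    · exact Or.inr ⟨i, rfl, (hdegT (hv i)).symm ▸ hdeg⟩
    · exact Or.inl ⟨Or.inr ⟨j, hj⟩, (hdegB hj).symm ▸ hdeg⟩

theorem IsStarSemiForest.exists_isStrongCover [Finite V] {H : D.G.Subgraph}
    (hH : D.IsStarSemiForest H) : ∃ C, D.IsStrongCover C ∧ H.verts ⊆ C := by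
  obtain ⟨r, t, T, v, B, hT, hB, rfl, hTT, hBB, hTB, u, hu, W₁, W₂, hW, -, hstable, hheavy, hW₂,
    hout⟩ := hH
  have hinner := inner_iSup_sup_iSup (fun i => (hT i).1) hTT hBB hTB
  set H : D.G.Subgraph := (⨆ i, T i) ⊔ ⨆ j, B j with hHdef
  refine exists_isStrongCover_of_isIndepSet (P := W₂ ∪ D.inner H v) hstable ?_ ?_ hout ?_
  · rw [hinner]
    exact Set.union_subset hheavy (Set.union_subset
      (Set.iUnion_subset fun i => (hT i).inner_subset_heavy)
      (Set.iUnion_subset fun j => (hB j).inner_subset_heavy))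
  · refine Set.disjoint_right.2 fun x hx => ?_
    obtain ⟨i, rfl⟩ : x ∈ Set.range u := hW ▸ Or.inl hx
    exact (hu i).1
  · intro x hx
    have hsource {y : V} (hy : y ∈ D.inner H v) (hyx : D.arc y x) :
        (∃ y ∈ W₁, D.G.Adj x y) ∨ ∃ y ∈ W₂ ∪ D.inner H v, D.arc y x :=
      Or.inr ⟨y, Or.inr hy, hyx⟩
    simp only [hHdef, SimpleGraph.Subgraph.verts_sup, SimpleGraph.Subgraph.verts_iSup,
      Set.mem_union, Set.mem_iUnion] at hx
    rcases hx with ⟨i, hi⟩ | ⟨j, hj⟩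
    · obtain rfl | hxv := eq_or_ne x (v i)
      · rcases (hW.ge ⟨i, rfl⟩ : u i ∈ W₁ ∪ W₂) with h₁ | h₂
        · exact Or.inl ⟨u i, h₁, (hu i).2⟩
        · exact Or.inr ⟨u i, Or.inl h₂, hW₂ i h₂⟩
      · obtain ⟨y, hy, hyx⟩ := (hT i).exists_inner_arc hi hxv
        exact hsource (hinner.ge (Or.inl (Set.mem_iUnion_of_mem i hy))) hyx
    · obtain ⟨y, hy, hyx⟩ := (hB j).exists_inner_arc hj
      exact hsource (hinner.ge (Or.inr (Set.mem_iUnion_of_mem j hy))) hyx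

end WeightedOrientedGraph

section Iterates

variable {α : Type*} (f : α → α)

theorem exists_iterate_mem_periodicPts [Finite α] (x : α) :
    ∃ n, f^[n] x ∈ Function.periodicPts f := by
  obtain ⟨m, n, hmn, heq⟩ := Finite.exists_ne_map_eq_of_infinite fun n : ℕ => f^[n] x
  wlog hlt : m < n generalizing m n
  · exact this n m hmn.symm heq.symm (by omega)
  refine ⟨m, Function.mk_mem_periodicPts (Nat.sub_pos_of_lt hlt) ?_⟩
  rw [Function.IsPeriodicPt, Function.IsFixedPt, ← Function.iterate_add_apply,
    Nat.sub_add_cancel hlt.le]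
  exact heq.symm

variable {f}

theorem exists_iterate_iterate_eq_of_mem_periodicPts {x : α} (hx : x ∈ Function.periodicPts f)
    (m : ℕ) : ∃ n, f^[n] (f^[m] x) = x := by
  obtain ⟨k, hk, hkx⟩ := hx
  refine ⟨k * m - m, ?_⟩
  rw [← Function.iterate_add_apply, Nat.sub_add_cancel (Nat.le_mul_of_pos_left m hk)]
  exact hkx.mul_const m

theorem subset_periodicPts_of_bijOn {s : Set α} (hs : s.Finite) (hf : Set.BijOn f s s) :
    s ⊆ Function.periodicPts f := by
  intro x hx
  have := hs.to_subtype
  have hinj : Function.Injective (hf.mapsTo.restrict f s s) := hf.mapsTo.restrict_inj.2 hf.injOn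
  have hsemiconj : Function.Semiconj (Subtype.val : s → α) (hf.mapsTo.restrict f s s) f :=
    fun _ => rfl
  exact hsemiconj.mapsTo_periodicPts (hinj.mem_periodicPts ⟨x, hx⟩)

theorem bijOn_of_surjOn_self {s : Set α} (hs : s.Finite) (hf : Set.SurjOn f s s) :
    Set.BijOn f s s := by
  have himage : f '' s = s :=
    (Set.eq_of_subset_of_ncard_le hf (Set.ncard_image_le hs) (hs.image f)).symm
  exact ⟨Set.mapsTo_iff_image_subset.2 himage.le,
    Set.injOn_of_ncard_image_eq (congrArg Set.ncard himage) hs, hf⟩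

variable (f) in
/-- Two points are equivalent when their forward orbits under `f` meet; the classes are the
connected components of the functional graph of `f`. -/
def forwardOrbitSetoid : Setoid α where
  r x y := ∃ m n, f^[m] x = f^[n] y
  iseqv :=
    { refl := fun _ => ⟨0, 0, rfl⟩
      symm := fun ⟨m, n, h⟩ => ⟨n, m, h.symm⟩
      trans := by
        rintro x y z ⟨m, n, hxy⟩ ⟨k, l, hyz⟩
        refine ⟨k + m, n + l, ?_⟩
        rw [Function.iterate_add_apply, hxy, ← Function.iterate_add_apply, add_comm k n,
          Function.iterate_add_apply, hyz, ← Function.iterate_add_apply] }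

theorem forwardOrbitSetoid_apply_left (x : α) : forwardOrbitSetoid f (f x) x :=
  ⟨0, 1, rfl⟩

theorem exists_iterate_eq_of_isFixedPt {x y : α} (hy : f y = y) (hxy : forwardOrbitSetoid f x y) :
    ∃ n, f^[n] x = y := by
  obtain ⟨m, n, hmn⟩ := hxy
  exact ⟨m, hmn.trans (Function.iterate_fixed hy n)⟩

variable (f) in
/-- The part of `s` in a connected component of the functional graph of `f`. -/
def orbitComponent (s : Set α) (c : Quotient (forwardOrbitSetoid f)) : Set α :=
  {x ∈ s | Quotient.mk _ x = c}

variable {s : Set α}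

theorem forwardOrbitSetoid_of_mem_orbitComponent {c : Quotient (forwardOrbitSetoid f)} :
    ∀ x ∈ orbitComponent f s c, ∀ y ∈ orbitComponent f s c, forwardOrbitSetoid f x y :=
  fun _ hx _ hy => Quotient.exact (hx.2.trans hy.2.symm)

theorem pairwise_disjoint_orbitComponent :
    Pairwise (Function.onFun Disjoint (orbitComponent f s)) :=
  fun _ _ hne => Set.disjoint_left.2 fun _ hx hy => hne (hx.2.symm.trans hy.2)

theorem mapsTo_orbitComponent (hs : Set.MapsTo f s s) (c : Quotient (forwardOrbitSetoid f)) :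
    Set.MapsTo f (orbitComponent f s c) (orbitComponent f s c) :=
  fun x hx => ⟨hs hx.1, (Quotient.sound (forwardOrbitSetoid_apply_left x)).trans hx.2⟩

end Iterates

namespace WeightedOrientedGraph

variable {V : Type*} {D : WeightedOrientedGraph V}

theorem exists_isOrientedCycle_of_hasOrientedPath {H : D.G.Subgraph} {x y : V}
    (hxy : D.HasOrientedPath H x y) (hyx : D.arcIn H y x) :
    ∃ C ≤ H, D.IsOrientedCycle C := by
  obtain ⟨p, hp, hor, hle⟩ := hxy
  have hedge : s(y, x) ∉ p.edges := by
    intro hmem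
    obtain ⟨d, hd, hde⟩ := List.mem_map.1 hmem
    have hsnd : d.snd = x := by
      rcases SimpleGraph.dart_edge_eq_mk'_iff'.1 hde with ⟨-, h⟩ | ⟨hfst, hsnd⟩
      · exact h
      · have hdarc := hor d hd
        rw [hfst, hsnd] at hdarc
        exact (D.arc_asymm _ _ hyx.2 hdarc).elim
    have hnodup := hp.support_nodup
    rw [← p.cons_map_snd_darts, List.nodup_cons] at hnodup
    exact hnodup.1 (List.mem_map.2 ⟨d, hd, hsnd⟩)
  refine ⟨(SimpleGraph.Walk.cons (H.adj_sub hyx.1) p).toSubgraph,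
    sup_le (SimpleGraph.subgraphOfAdj_le_of_adj H hyx.1) hle, _, _,
    (SimpleGraph.Walk.cons_isCycle_iff _ _).2 ⟨hp, hedge⟩, fun d hd => ?_, rfl⟩
  rw [SimpleGraph.Walk.darts_cons, List.mem_cons] at hd
  rcases hd with rfl | hd
  · exact hyx.2
  · exact hor d hd

variable (D) in
/-- The subgraph on `S` whose oriented edges are the arcs from `q x` to `x`, where `q` is thought of
as assigning to each vertex its parent. -/
def parentSubgraph (q : V → V) (S : Set V) : D.G.Subgraph where
  verts := S
  Adj a b := a ∈ S ∧ b ∈ S ∧ ((D.arc a b ∧ q b = a) ∨ (D.arc b a ∧ q a = b))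
  adj_sub h := (D.adj_iff _ _).2 (h.2.2.imp And.left And.left)
  edge_vert h := h.1
  symm := ⟨fun _ _ h => ⟨h.2.1, h.1, h.2.2.symm⟩⟩

variable {q : V → V} {S : Set V}

theorem exists_child_or_forall_adj_eq_parent {H : D.G.Subgraph} (hH : H ≤ D.parentSubgraph q S)
    (x : V) : (∃ z, D.arcIn H x z ∧ q z = x) ∨ ∀ y, H.Adj x y → q x = y := by
  by_contra! h
  obtain ⟨hchild, y, hxy, hne⟩ := h
  obtain ⟨harc, hq⟩ := (hH.2 hxy).2.2.resolve_right fun hyx => hne hyx.2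
  exact hchild y ⟨hxy, harc⟩ hq

theorem exists_child_of_two_le_deg {H : D.G.Subgraph} (hH : H ≤ D.parentSubgraph q S) {x : V}
    (hx : 2 ≤ D.deg H x) : ∃ z, D.arcIn H x z ∧ q z = x := by
  refine (exists_child_or_forall_adj_eq_parent hH x).resolve_right fun hpar => ?_
  have hsub : H.neighborSet x ⊆ {q x} := fun y hy => (hpar y hy).symm
  have hcard := Set.ncard_le_ncard hsub
  rw [Set.ncard_singleton] at hcard
  exact absurd (hx.trans hcard) (by decide)

section Cycles

variable {C : D.G.Subgraph} (hC : C ∈ D.cycles (D.parentSubgraph q S))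
include hC

theorem exists_child_of_mem_cycles {x : V} (hx : x ∈ C.verts) : ∃ z, D.arcIn C x z ∧ q z = x := by
  refine exists_child_of_two_le_deg hC.1 ?_
  obtain ⟨-, c, p, hp, rfl⟩ := hC
  exact (hp.ncard_neighborSet_toSubgraph_eq_two (p.mem_verts_toSubgraph.1 hx)).ge

theorem bijOn_verts_of_mem_cycles [Finite V] : Set.BijOn q C.verts C.verts := by
  refine bijOn_of_surjOn_self (Set.toFinite _) fun x hx => ?_
  obtain ⟨z, hxz, hz⟩ := exists_child_of_mem_cycles hC hx
  exact ⟨z, C.edge_vert hxz.1.symm, hz⟩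

theorem eq_parentSubgraph_of_mem_cycles [Finite V] : C = D.parentSubgraph q C.verts := by
  have hbij := bijOn_verts_of_mem_cycles hC
  have hadj {x : V} (hx : x ∈ C.verts) : C.Adj (q x) x := by
    obtain ⟨z, hxz, hz⟩ := exists_child_of_mem_cycles hC (hbij.mapsTo hx)
    obtain rfl : z = x := hbij.injOn (C.edge_vert hxz.1.symm) hx hz
    exact hxz.1
  refine SimpleGraph.Subgraph.ext rfl ?_
  ext a b
  refine ⟨fun hab => ⟨C.edge_vert hab, C.edge_vert hab.symm, (hC.1.2 hab).2.2⟩, ?_⟩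
  · rintro ⟨ha, hb, ⟨-, rfl⟩ | ⟨-, rfl⟩⟩
    · exact hadj hb
    · exact (hadj ha).symm

theorem verts_eq_inter_periodicPts_of_mem_cycles [Finite V]
    (hS : ∀ x ∈ S, ∀ y ∈ S, forwardOrbitSetoid q x y) :
    C.verts = S ∩ Function.periodicPts q := by
  have hbij := bijOn_verts_of_mem_cycles hC
  refine subset_antisymm
    (Set.subset_inter hC.1.1 (subset_periodicPts_of_bijOn (Set.toFinite _) hbij)) ?_
  rintro x ⟨hxS, hxper⟩
  obtain ⟨c, hc⟩ : C.verts.Nonempty := by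
    obtain ⟨-, c, p, -, rfl⟩ := hC
    exact ⟨c, p.start_mem_verts_toSubgraph⟩
  obtain ⟨m, n, hmn⟩ := hS x hxS c (hC.1.1 hc)
  obtain ⟨k, hk⟩ := exists_iterate_iterate_eq_of_mem_periodicPts hxper m
  rw [← hk, hmn]
  exact hbij.mapsTo.iterate k (hbij.mapsTo.iterate n hc)

end Cycles

/-- `q` assigns to each vertex of `S` a parent in `S`: a vertex of weight greater than one with an
arc to it. A vertex without a parent is encoded as a fixed point of `q`. -/
structure IsParentFunction (D : WeightedOrientedGraph V) (q : V → V) (S : Set V) : Prop where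
  mapsTo : Set.MapsTo q S S
  arc : ∀ x ∈ S, q x ≠ x → D.arc (q x) x
  heavy : ∀ x ∈ S, q x ≠ x → q x ∈ D.heavy

namespace IsParentFunction

variable (h : D.IsParentFunction q S)
include h

theorem arcIn {x : V} (hx : x ∈ S) (hfix : q x ≠ x) : D.arcIn (D.parentSubgraph q S) (q x) x :=
  ⟨⟨h.mapsTo hx, hx, Or.inl ⟨h.arc x hx hfix, rfl⟩⟩, h.arc x hx hfix⟩

theorem hasOrientedPath_iterate (n : ℕ) {x : V} (hx : x ∈ S) :
    D.HasOrientedPath (D.parentSubgraph q S) (q^[n] x) x := by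
  refine hasOrientedPath_of_reflTransGen_arcIn (h.mapsTo.iterate n hx) ?_
  induction n generalizing x with
  | zero => exact Relation.ReflTransGen.refl
  | succ n ih =>
    have hpath := ih (h.mapsTo hx)
    rw [Function.iterate_succ_apply]
    by_cases hfix : q x = x
    · rwa [hfix] at hpath ⊢
    · exact hpath.tail (h.arcIn hx hfix)

theorem deg_eq_one {x : V} (hx : x ∈ S) (hfix : q x ≠ x) (hw : D.w x = 1) :
    D.deg (D.parentSubgraph q S) x = 1 := by
  have hnbr : (D.parentSubgraph q S).neighborSet x = {q x} := by
    refine Set.eq_singleton_iff_unique_mem.2 ⟨(h.arcIn hx hfix).1.symm, ?_⟩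
    rintro y ⟨-, hy, ⟨harc, rfl⟩ | ⟨-, hxy⟩⟩
    · exact ((h.heavy y hy (arc_ne harc)).ne' hw).elim
    · exact hxy.symm
  rw [deg, hnbr, Set.ncard_singleton]

theorem isROT [Finite V] {r : V} (hr : r ∈ S) (hfix : q r = r)
    (hS : ∀ x ∈ S, ∀ y ∈ S, forwardOrbitSetoid q x y) : D.IsROT (D.parentSubgraph q S) r := by
  have hreach {x : V} (hx : x ∈ S) : ∃ n, q^[n] x = r :=
    exists_iterate_eq_of_isFixedPt hfix (hS x hx r hr)
  have hne {x : V} (hx : x ∈ S) (hxr : x ≠ r) : q x ≠ x := by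
    intro hqx
    obtain ⟨n, hn⟩ := hreach hx
    exact hxr ((Function.iterate_fixed hqx n).symm.trans hn)
  refine ⟨hr, Set.eq_empty_of_forall_notMem fun C hC => ?_, ?_, fun x hx hw => ?_⟩
  · have hrC : r ∈ C.verts := by
      rw [verts_eq_inter_periodicPts_of_mem_cycles hC hS]
      exact ⟨hr, Function.mk_mem_periodicPts one_pos hfix⟩
    obtain ⟨z, hrz, hz⟩ := exists_child_of_mem_cycles hC hrC
    have hbij := bijOn_verts_of_mem_cycles hC
    exact hrz.1.ne (hbij.injOn hrC (C.edge_vert hrz.1.symm) (hfix.trans hz.symm))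
  · rintro x ⟨hx, -⟩
    obtain ⟨n, rfl⟩ := hreach hx
    exact h.hasOrientedPath_iterate n hx
  · refine (eq_or_ne x r).symm.imp (fun hxr => ⟨h.deg_eq_one hx (hne hx hxr) hw, hxr⟩) ?_
    rintro rfl
    refine ⟨Set.eq_singleton_iff_unique_mem.2 ⟨hx, fun y hy => ?_⟩, rfl⟩
    obtain ⟨n, hn⟩ := hreach hy
    induction n generalizing y with
    | zero => exact hn
    | succ n ih =>
      have hqy : q y = x := ih (q y) (h.mapsTo hy) hn
      by_contra hyx
      exact (hqy ▸ h.heavy y hy (hne hy hyx) : x ∈ D.heavy).ne' hw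

theorem isUnicycle [Finite V] (hne : S.Nonempty) (hfix : ∀ x ∈ S, q x ≠ x)
    (hS : ∀ x ∈ S, ∀ y ∈ S, forwardOrbitSetoid q x y) : D.IsUnicycle (D.parentSubgraph q S) := by
  have hperiodic {x : V} (hx : x ∈ S) : ∃ n, q^[n] x ∈ S ∩ Function.periodicPts q := by
    obtain ⟨n, hn⟩ := exists_iterate_mem_periodicPts q x
    exact ⟨n, h.mapsTo.iterate n hx, hn⟩
  obtain ⟨C, hCS, hor⟩ : ∃ C ≤ D.parentSubgraph q S, D.IsOrientedCycle C := by
    obtain ⟨x, hx⟩ := hne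
    obtain ⟨n, hn, hper⟩ := hperiodic hx
    obtain ⟨k, hk⟩ := exists_iterate_iterate_eq_of_mem_periodicPts hper 1
    have hpath := h.hasOrientedPath_iterate k (h.mapsTo hn)
    rw [Function.iterate_one] at hk
    rw [hk] at hpath
    exact exists_isOrientedCycle_of_hasOrientedPath hpath (h.arcIn hn (hfix _ hn))
  have hC : C ∈ D.cycles (D.parentSubgraph q S) := by
    obtain ⟨c, p, hp, -, hpC⟩ := hor
    exact ⟨hCS, c, p, hp, hpC⟩
  have hverts {C' : D.G.Subgraph} (hC' : C' ∈ D.cycles (D.parentSubgraph q S)) :=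
    verts_eq_inter_periodicPts_of_mem_cycles hC' hS
  refine ⟨C, Set.eq_singleton_iff_unique_mem.2 ⟨hC, fun C' hC' => ?_⟩, hor, ?_,
    fun x hx => h.deg_eq_one hx (hfix x hx)⟩
  · rw [eq_parentSubgraph_of_mem_cycles hC', hverts hC', ← hverts hC,
      ← eq_parentSubgraph_of_mem_cycles hC]
  · rintro y ⟨hy, -⟩
    obtain ⟨n, hn⟩ := hperiodic hy
    exact ⟨q^[n] y, (hverts hC).ge hn, h.hasOrientedPath_iterate n hy⟩

end IsParentFunction

theorem parentSubgraph_eq_iSup_orbitComponent :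
    D.parentSubgraph q S =
      ⨆ (c) (_ : (orbitComponent q S c).Nonempty), D.parentSubgraph q (orbitComponent q S c) := by
  have hclass (x : V) :
      (Quotient.mk _ (q x) : Quotient (forwardOrbitSetoid q)) = Quotient.mk _ x :=
    Quotient.sound (forwardOrbitSetoid_apply_left x)
  refine SimpleGraph.Subgraph.ext ?_ ?_
  · ext x
    simp only [SimpleGraph.Subgraph.verts_iSup, Set.mem_iUnion, exists_prop]
    exact ⟨fun hx => ⟨_, ⟨x, hx, rfl⟩, hx, rfl⟩, fun ⟨_, _, hx⟩ => hx.1⟩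
  · ext a b
    simp only [SimpleGraph.Subgraph.iSup_adj, exists_prop]
    refine ⟨fun ⟨ha, hb, hab⟩ => ⟨Quotient.mk _ b, ⟨b, hb, rfl⟩, ⟨ha, ?_⟩, ⟨hb, rfl⟩, hab⟩,
      fun ⟨_, _, ha, hb, hab⟩ => ⟨ha.1, hb.1, hab⟩⟩
    rcases hab with ⟨-, rfl⟩ | ⟨-, rfl⟩
    · exact hclass b
    · exact (hclass a).symm

namespace IsParentFunction

theorem restrict_orbitComponent (h : D.IsParentFunction q S) (c : Quotient (forwardOrbitSetoid q)) :
    D.IsParentFunction q (orbitComponent q S c) where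
  mapsTo := mapsTo_orbitComponent h.mapsTo c
  arc x hx := h.arc x hx.1
  heavy x hx := h.heavy x hx.1

theorem exists_forest [Finite V] (h : D.IsParentFunction q S) :
    ∃ (r t : ℕ) (T : Fin r → D.G.Subgraph) (v : Fin r → V) (B : Fin t → D.G.Subgraph),
      (∀ i, D.IsROT (T i) (v i)) ∧
      (∀ j, D.IsUnicycle (B j)) ∧
      D.parentSubgraph q S = (⨆ i, T i) ⊔ (⨆ j, B j) ∧
      (∀ i i', i ≠ i' → Disjoint (T i).verts (T i').verts) ∧
      (∀ j j', j ≠ j' → Disjoint (B j).verts (B j').verts) ∧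
      (∀ i j, Disjoint (T i).verts (B j).verts) ∧
      ∀ i, q (v i) = v i := by
  let component := orbitComponent q S
  let Rooted (c) : Prop := ∃ x ∈ component c, q x = x
  let Rootless (c) : Prop := (component c).Nonempty ∧ ∀ x ∈ component c, q x ≠ x
  obtain ⟨r, ⟨er⟩⟩ := Finite.exists_equiv_fin {c // Rooted c}
  obtain ⟨t, ⟨et⟩⟩ := Finite.exists_equiv_fin {c // Rootless c}
  let F (c) := D.parentSubgraph q (component c)
  choose v hv hfix using fun i => (er.symm i).2
  refine ⟨r, t, fun i => F (er.symm i), v, fun j => F (et.symm j), fun i => ?_, fun j => ?_, ?_,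
    fun i i' hne => ?_, fun j j' hne => ?_, fun i j => ?_, hfix⟩
  · exact (h.restrict_orbitComponent _).isROT (hv i) (hfix i)
      forwardOrbitSetoid_of_mem_orbitComponent
  · exact (h.restrict_orbitComponent _).isUnicycle (et.symm j).2.1 (et.symm j).2.2
      forwardOrbitSetoid_of_mem_orbitComponent
  · refine parentSubgraph_eq_iSup_orbitComponent.trans
      (le_antisymm (iSup₂_le fun c hc => ?_) (sup_le (iSup_le fun i => ?_) (iSup_le fun j => ?_)))
    · by_cases hroot : Rooted c
      · exact le_sup_of_le_left (le_iSup_of_le (er ⟨c, hroot⟩) (by simp [F, component]))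
      · have hrootless : Rootless c := ⟨hc, by simpa only [Rooted, not_exists, not_and] using hroot⟩
        exact le_sup_of_le_right (le_iSup_of_le (et ⟨c, hrootless⟩) (by simp [F, component]))
    · exact le_iSup₂_of_le _ ⟨v i, hv i⟩ le_rfl
    · exact le_iSup₂_of_le _ (et.symm j).2.1 le_rfl
  · exact pairwise_disjoint_orbitComponent fun heq => hne (er.symm.injective (Subtype.ext heq))
  · exact pairwise_disjoint_orbitComponent fun heq => hne (et.symm.injective (Subtype.ext heq))
  · exact pairwise_disjoint_orbitComponent fun heq =>
      (et.symm j).2.2 (v i) (heq ▸ hv i) (hfix i)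

end IsParentFunction

theorem exists_child_of_mem_inner [Finite V] {r : ℕ} {v : Fin r → V} (hv : ∀ i, q (v i) = v i)
    {x : V} (hx : x ∈ D.inner (D.parentSubgraph q S) v) : ∃ z ∈ S, D.arc x z ∧ q z = x := by
  suffices h : ∃ z, D.arcIn (D.parentSubgraph q S) x z ∧ q z = x by
    obtain ⟨z, hxz, hz⟩ := h
    exact ⟨z, hxz.1.2.1, hxz.2, hz⟩
  rcases hx with ⟨-, hdeg⟩ | ⟨i, rfl, hdeg⟩
  · exact exists_child_of_two_le_deg le_rfl hdeg
  · obtain ⟨y, hy⟩ := (Set.ncard_pos (Set.toFinite _)).1 (hdeg ▸ one_pos)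
    have hy : (D.parentSubgraph q S).Adj (v i) y := hy
    exact (exists_child_or_forall_adj_eq_parent le_rfl (v i)).resolve_right fun hpar =>
      hy.ne ((hv i).symm.trans (hpar y hy))

theorem IsStrongCover.exists_supporter_or_exists_notMem {C : Set V} (hC : D.IsStrongCover C)
    {x : V} (hx : x ∈ S) (hSC : S ⊆ C) :
    (∃ y ∈ S, y ∈ D.supporters C ∧ D.arc y x) ∨
      ∃ y ∉ S, D.G.Adj x y ∧ (y ∈ C → y ∈ D.supporters C ∧ D.arc y x) := by
  by_cases hN : ∀ y, D.G.Adj x y → y ∈ C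
  · obtain ⟨y, hy, hyx⟩ := hC.2 x (hSC hx) hN
    by_cases hyS : y ∈ S
    · exact Or.inl ⟨y, hyS, hy, hyx⟩
    · exact Or.inr ⟨y, hyS, (adj_of_arc hyx).symm, fun _ => ⟨hy, hyx⟩⟩
  · push Not at hN
    obtain ⟨y, hxy, hyC⟩ := hN
    exact Or.inr ⟨y, fun hy => hyC (hSC hy), hxy, fun hy => (hyC hy).elim⟩

theorem IsStrongCover.exists_isParentFunction {C : Set V} (hC : D.IsStrongCover C) (hSC : S ⊆ C) :
    ∃ q u : V → V, D.IsParentFunction q S ∧ (∀ x ∈ S, q x ≠ x → q x ∈ D.supporters C) ∧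
      ∀ x ∈ S, q x = x →
        u x ∉ S ∧ D.G.Adj x (u x) ∧ (u x ∈ C → u x ∈ D.supporters C ∧ D.arc (u x) x) := by
  have hchoice (x : V) : ∃ p u, x ∈ S → (p ∈ S ∧ p ∈ D.supporters C ∧ D.arc p x) ∨
      (p = x ∧ u ∉ S ∧ D.G.Adj x u ∧ (u ∈ C → u ∈ D.supporters C ∧ D.arc u x)) := by
    by_cases hx : x ∈ S
    · obtain ⟨y, hy⟩ | ⟨y, hy⟩ := hC.exists_supporter_or_exists_notMem hx hSC
      · exact ⟨y, x, fun _ => Or.inl hy⟩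
      · exact ⟨x, y, fun _ => Or.inr ⟨rfl, hy⟩⟩
    · exact ⟨x, x, fun h => (hx h).elim⟩
  choose q u hqu using hchoice
  have hparent {x : V} (hx : x ∈ S) (hfix : q x ≠ x) :=
    (hqu x hx).resolve_right fun h => hfix h.1
  refine ⟨q, u, ⟨fun x hx => ?_, fun x hx hfix => (hparent hx hfix).2.2,
    fun x hx hfix => (hparent hx hfix).2.1.1⟩, fun x hx hfix => (hparent hx hfix).2.1,
    fun x hx hfix => ((hqu x hx).resolve_left fun h => arc_ne h.2.2 hfix).2⟩
  by_cases hfix : q x = x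
  · rwa [hfix]
  · exact (hparent hx hfix).1

theorem IsStrongCover.hasGeneratingStarSemiForest [Finite V] {C : Set V} (hC : D.IsStrongCover C)
    {K : D.G.Subgraph} (hK : K.verts ⊆ C) : D.HasGeneratingStarSemiForest K := by
  obtain ⟨q, u, hq, hsupp, hout⟩ := hC.exists_isParentFunction hK
  obtain ⟨r, t, T, v, B, hT, hB, hforest, hTT, hBB, hTB, hfix⟩ := hq.exists_forest
  have hv (i : Fin r) : v i ∈ K.verts := by
    have hle : T i ≤ D.parentSubgraph q K.verts :=
      (le_iSup T i).trans (le_sup_left.trans hforest.ge)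
    exact hle.1 (hT i).1
  have hu (i : Fin r) := hout (v i) (hv i) (hfix i)
  refine ⟨D.parentSubgraph q K.verts, ⟨r, t, T, v, B, hT, hB, hforest, hTT, hBB, hTB,
    fun i => u (v i), fun i => ⟨(hu i).1, (hu i).2.1⟩, Set.range (fun i => u (v i)) \ C,
    Set.range (fun i => u (v i)) ∩ C, Set.sdiff_union_inter _ _,
    Set.disjoint_left.2 fun x hx hx' => hx.2 hx'.2, fun a ha b hb _ hab => ?_, ?_,
    fun i hi => ((hu i).2.2 hi.2).2, fun x hx y hy hxy => hy.2 ?_⟩, rfl⟩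
  · exact (hC.1 hab).elim ha.2 hb.2
  · rintro _ ⟨⟨i, rfl⟩, hi⟩
    exact ((hu i).2.2 hi).1.1
  · suffices hx : x ∈ D.supporters C from hx.2 y hxy
    rcases hx with ⟨⟨i, rfl⟩, hi⟩ | hx
    · exact ((hu i).2.2 hi).1
    · obtain ⟨z, hz, hxz, rfl⟩ := exists_child_of_mem_inner hfix hx
      exact hsupp z hz (arc_ne hxz)

theorem hasGeneratingStarSemiForest_iff [Finite V] {K : D.G.Subgraph} :
    D.HasGeneratingStarSemiForest K ↔ ∃ C, D.IsStrongCover C ∧ K.verts ⊆ C := by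
  constructor
  · rintro ⟨H, hH, hKH⟩
    rw [hKH]
    exact hH.exists_isStrongCover
  · rintro ⟨C, hC, hK⟩
    exact hC.hasGeneratingStarSemiForest hK

end WeightedOrientedGraph

section PerfectGraphs

open Finset SimpleGraph

variable {V : Type*}

theorem card_le_card_of_disjoint_of_card_inter_eq_one {ι : Type*} [Fintype ι] [Fintype V]
    [DecidableEq V] {Q S : ι → Finset V} (hdisj : ∀ i, Disjoint (Q i) (S i))
    (hone : ∀ i j, j ≠ i → #(Q i ∩ S j) = 1) (hι : Fintype.card ι ≠ 1) :
    Fintype.card ι ≤ Fintype.card V := by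
  classical
  let indicator (j : ι) (v : V) : ℚ := if v ∈ S j then 1 else 0
  have hsum (i j) : ∑ v ∈ Q i, indicator j v = if j = i then 0 else 1 := by
    rw [sum_boole, filter_mem_eq_inter]
    split_ifs with hij
    · rw [hij, disjoint_iff_inter_eq_empty.1 (hdisj i), card_empty, Nat.cast_zero]
    · rw [hone i j hij, Nat.cast_one]
  have hindep : LinearIndependent ℚ indicator := by
    refine Fintype.linearIndependent_iff.2 fun x hx => ?_
    have hconst (i) : x i = ∑ j, x j := by
      have hzero : ∑ j, x j * ∑ v ∈ Q i, indicator j v = 0 := by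
        simp only [mul_sum]
        rw [sum_comm]
        refine sum_eq_zero fun v _ => ?_
        simpa only [Finset.sum_apply, Pi.smul_apply, smul_eq_mul, Pi.zero_apply] using congrFun hx v
      simp only [hsum, mul_ite, mul_zero, mul_one] at hzero
      rw [← add_sum_erase univ x (mem_univ i), left_eq_add, ← hzero,
        ← add_sum_erase univ _ (mem_univ i), if_pos rfl, zero_add]
      exact sum_congr rfl fun j hj => (if_neg (ne_of_mem_erase hj)).symm
    have htotal : ∑ j, x j = Fintype.card ι * ∑ j, x j := by
      conv_lhs => rw [sum_congr rfl fun j _ => hconst j]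
      rw [sum_const, card_univ, nsmul_eq_mul]
    intro i
    rw [hconst i]
    exact (mul_right_eq_self₀.1 ((mul_comm _ _).trans htotal.symm)).resolve_left
      (by exact_mod_cast hι)
  simpa only [Module.finrank_fintype_fun_eq_card] using hindep.fintype_card_le_finrank

variable {G : SimpleGraph V}

theorem card_inter_le_one_of_isClique_of_isIndepSet [DecidableEq V] {Q S : Finset V}
    (hQ : G.IsClique Q) (hS : G.IsIndepSet S) : #(Q ∩ S) ≤ 1 := by
  refine card_le_one.2 fun v hv w hw => by_contra fun hvw => ?_
  rw [mem_inter] at hv hw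
  exact hS hv.2 hw.2 hvw (hQ hv.1 hw.1 hvw)

theorem colorable_succ_of_isIndepSet_of_induce_compl {S : Set V} {n : ℕ} (hS : G.IsIndepSet S)
    (hn : (G.induce Sᶜ).Colorable n) : G.Colorable (n + 1) := by
  classical
  obtain ⟨c⟩ := hn
  let d (v : V) : Option (Fin n) := if h : v ∈ S then none else some (c ⟨v, h⟩)
  refine (Coloring.mk d fun {v w} hvw heq => ?_).colorable.mono (by simp)
  by_cases hv : v ∈ S <;> by_cases hw : w ∈ S <;>
    simp only [d, hv, hw, dite_true, dite_false, reduceCtorEq, Option.some.injEq] at heq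
  · exact hS hv hw hvw.ne hvw
  · exact c.valid (v := ⟨v, hv⟩) (w := ⟨w, hw⟩) hvw heq

/-- The sets are `T` and the colour classes of an `n`-colouring of `G - a`, for each `a ∈ T`. -/
theorem exists_isIndepSet_family_card_eq [Finite V] [DecidableEq V] {T : Finset V} {n : ℕ}
    (hT : G.IsIndepSet T) (hn : ∀ a ∈ T, (G.induce {a}ᶜ).Colorable n) :
    ∃ S : Option (T × Fin n) → Finset V,
      (∀ i, G.IsIndepSet (S i)) ∧ ∀ v, #{i | v ∈ S i} = #T := by
  classical
  cases nonempty_fintype V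
  let c (a : T) : (G.induce {(a : V)}ᶜ).Coloring (Fin n) := (hn a a.2).some
  let S : Option (T × Fin n) → Finset V
    | none => T
    | some (a, k) => {v | ∃ h : v ≠ a, c a ⟨v, h⟩ = k}
  refine ⟨S, ?_, fun v => ?_⟩
  · rintro (_ | ⟨a, k⟩)
    · exact hT
    · intro v hv w hw _ hvw
      obtain ⟨hva, hv⟩ := (mem_filter.1 hv).2
      obtain ⟨hwa, hw⟩ := (mem_filter.1 hw).2
      exact (c a).valid (v := ⟨v, hva⟩) (w := ⟨w, hwa⟩) hvw (hv.trans hw.symm)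
  · let index (a : T) : Option (T × Fin n) :=
      if h : v = a then none else some (a, c a ⟨v, h⟩)
    have hindex : ({i | v ∈ S i} : Finset _) = univ.image index := by
      ext (_ | ⟨a, k⟩)
      · simp [S, index, dite_eq_iff]
      · simp only [S, mem_filter, mem_univ, true_and, mem_image, index, dite_eq_iff,
          reduceCtorEq, exists_false, false_or, Option.some.injEq, Prod.mk.injEq]
        exact ⟨fun ⟨h, hk⟩ => ⟨a, h, rfl, hk⟩, by rintro ⟨b, h, rfl, hk⟩; exact ⟨h, hk⟩⟩
    have hinj : Function.Injective index := by
      intro a b hab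
      simp only [index] at hab
      split_ifs at hab with ha hb
      · exact Subtype.ext (ha.symm.trans hb)
      · exact congrArg Prod.fst (Option.some.inj hab)
    rw [hindex, card_image_of_injective _ hinj, card_univ, Fintype.card_coe]

theorem cliqueNum_le_of_embedding {W : Type*} [Finite W] {F : SimpleGraph W} (f : G ↪g F) :
    G.cliqueNum ≤ F.cliqueNum := by
  have : Finite V := .of_injective f f.injective
  obtain ⟨s, hs⟩ := G.exists_isNClique_cliqueNum
  have hfs : F.IsNClique G.cliqueNum (s.map f.toEmbedding) :=
    (hs.map (f := f.toEmbedding)).mono (SimpleGraph.map_le_iff_le_comap _ _ _ |>.2 f.comap_eq.ge)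
  exact hfs.card_eq.ge.trans hfs.isClique.card_le_cliqueNum

theorem cliqueNum_congr {W : Type*} [Finite V] {F : SimpleGraph W} (e : G ≃g F) :
    G.cliqueNum = F.cliqueNum :=
  have : Finite W := .of_equiv V e.toEquiv
  (cliqueNum_le_of_embedding e.toEmbedding).antisymm (cliqueNum_le_of_embedding e.symm.toEmbedding)

/-- A minimally imperfect graph: its chromatic number exceeds its clique number, but this is not
the case for any proper induced subgraph. -/
def IsMinimallyImperfect (G : SimpleGraph V) : Prop :=
  ¬ G.Colorable G.cliqueNum ∧
    ∀ A : Set V, A ≠ Set.univ → (G.induce A).Colorable (G.induce A).cliqueNum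

namespace IsMinimallyImperfect

theorem colorable_induce [Finite V] (h : IsMinimallyImperfect G) {A : Set V} (hA : A ≠ Set.univ) :
    (G.induce A).Colorable G.cliqueNum :=
  (h.2 A hA).mono (G.cliqueNum_induce_le A)

theorem exists_isNClique_disjoint [Finite V] (h : IsMinimallyImperfect G) {S : Finset V}
    (hS : G.IsIndepSet S) : ∃ Q, G.IsNClique G.cliqueNum Q ∧ Disjoint Q S := by
  obtain rfl | ⟨x, hx⟩ := S.eq_empty_or_nonempty
  · obtain ⟨Q, hQ⟩ := G.exists_isNClique_cliqueNum
    exact ⟨Q, hQ, disjoint_empty_right Q⟩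
  have hne : (S : Set V)ᶜ ≠ Set.univ := fun huniv => (huniv ▸ Set.mem_univ x : x ∈ (S : Set V)ᶜ) hx
  have hnum : (G.induce (S : Set V)ᶜ).cliqueNum = G.cliqueNum := by
    refine (G.cliqueNum_induce_le _).antisymm (not_lt.1 fun hlt => h.1 ?_)
    exact (colorable_succ_of_isIndepSet_of_induce_compl hS (h.2 _ hne)).mono hlt
  obtain ⟨Q, hQ⟩ := (G.induce (S : Set V)ᶜ).exists_isNClique_cliqueNum
  rw [isNClique_induce_iff, hnum] at hQ
  refine ⟨_, hQ, Finset.disjoint_left.2 fun v hv => ?_⟩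
  obtain ⟨w, -, rfl⟩ := mem_map.1 hv
  exact w.2

theorem nonempty (h : IsMinimallyImperfect G) : Nonempty V :=
  not_isEmpty_iff.1 fun _ => h.1 (.of_isEmpty _)

theorem cliqueNum_mul_indepNum_lt_card [Finite V] (h : IsMinimallyImperfect G) :
    G.cliqueNum * G.indepNum < Nat.card V := by
  classical
  cases nonempty_fintype V
  obtain ⟨T, hT⟩ := G.exists_isNIndepSet_indepNum
  obtain ⟨S, hS, hcount⟩ := exists_isIndepSet_family_card_eq (n := G.cliqueNum) hT.isIndepSet
    fun a _ => h.colorable_induce (Set.compl_ne_univ.2 (Set.singleton_nonempty a))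
  choose Q hQ hQS using fun i => h.exists_isNClique_disjoint (hS i)
  have hcard : Fintype.card (Option (T × Fin G.cliqueNum)) = G.cliqueNum * G.indepNum + 1 := by
    rw [Fintype.card_option, Fintype.card_prod, Fintype.card_coe, Fintype.card_fin, hT.card_eq,
      mul_comm]
  have hsum (i) : ∑ j ∈ univ.erase i, #(Q i ∩ S j) = ∑ j ∈ univ.erase i, 1 := by
    have hdiag : #(Q i ∩ S i) = 0 := card_eq_zero.2 (disjoint_iff_inter_eq_empty.1 (hQS i))
    have hdouble := sum_card_bipartiteAbove_eq_sum_card_bipartiteBelow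
      (s := Q i) (t := univ) fun v j => v ∈ S j
    simp only [bipartiteAbove, bipartiteBelow, hcount, filter_mem_eq_inter, sum_const, smul_eq_mul,
      (hQ i).card_eq, hT.card_eq] at hdouble
    rw [sum_const, smul_eq_mul, mul_one, card_erase_of_mem (mem_univ i), card_univ, hcard,
      Nat.add_sub_cancel, hdouble, ← add_sum_erase univ _ (mem_univ i), hdiag, zero_add]
  have hone (i j) (hij : j ≠ i) : #(Q i ∩ S j) = 1 :=
    (sum_eq_sum_iff_of_le fun j _ =>
      card_inter_le_one_of_isClique_of_isIndepSet (hQ i).isClique (hS j)).1 (hsum i) j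
      (mem_erase.2 ⟨hij, mem_univ j⟩)
  obtain hzero | hne := eq_or_ne (G.cliqueNum * G.indepNum) 0
  · have := h.nonempty
    exact hzero.trans_lt Nat.card_pos
  · rw [Nat.card_eq_fintype_card, ← Nat.succ_le_iff, Nat.succ_eq_add_one, ← hcard]
    exact card_le_card_of_disjoint_of_card_inter_eq_one hQS hone (by omega)

end IsMinimallyImperfect

theorem exists_isMinimallyImperfect_induce [Finite V]
    (h : ∃ A : Set V, ¬ (G.induce A).Colorable (G.induce A).cliqueNum) :
    ∃ A : Set V, IsMinimallyImperfect (G.induce A) := by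
  obtain ⟨A, hA⟩ := exists_minimal_of_wellFoundedLT _ h
  refine ⟨A, hA.prop, fun B hB => by_contra fun hBcol => hB ?_⟩
  have e : (G.induce A).induce B ≃g G.induce (Subtype.val '' B) :=
    ⟨Equiv.Set.image _ B Subtype.val_injective, Iff.rfl⟩
  rw [cliqueNum_congr e, colorable_congr e] at hBcol
  have hsub : Subtype.val '' B ⊆ A := by
    rintro _ ⟨v, -, rfl⟩
    exact v.2
  exact Set.eq_univ_of_forall fun v => by
    obtain ⟨w, hw, hwv⟩ := hA.le_of_le hBcol hsub v.2
    exact Subtype.ext hwv ▸ hw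

theorem card_le_mul_indepNum_of_colorable [Finite V] {n : ℕ} (hn : G.Colorable n) :
    Nat.card V ≤ n * G.indepNum := by
  classical
  cases nonempty_fintype V
  obtain ⟨c⟩ := hn
  have hclass (k : Fin n) : #{v | c v = k} ≤ G.indepNum :=
    IsIndepSet.card_le_indepNum (by simpa [Coloring.colorClass] using c.isIndepSet_colorClass k)
  calc Nat.card V = #(univ : Finset V) := Nat.card_eq_fintype_card
    _ ≤ G.indepNum * #(univ : Finset (Fin n)) :=
      card_le_mul_card_image_of_maps_to (fun v _ => mem_univ (c v)) _ fun k _ => hclass k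
    _ = n * G.indepNum := by rw [card_univ, Fintype.card_fin, mul_comm]

theorem isPerfectGraph_iff_colorable :
    G.IsPerfectGraph ↔ ∀ A : Set V, (G.induce A).Colorable (G.induce A).cliqueNum := by
  refine forall_congr' fun A => ?_
  rw [← chromaticNumber_le_iff_colorable]
  exact ⟨fun h => h.le, fun h => h.antisymm cliqueNum_le_chromaticNumber⟩

theorem isPerfectGraph_compl [Finite V] (hG : G.IsPerfectGraph) : Gᶜ.IsPerfectGraph := by
  rw [isPerfectGraph_iff_colorable] at hG ⊢
  by_contra! hcon
  obtain ⟨A, hA⟩ := exists_isMinimallyImperfect_induce hcon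
  have hcompl : Gᶜ.induce A = (G.induce A)ᶜ := by
    ext v w
    simp [Subtype.ext_iff]
  have hlt := hA.cliqueNum_mul_indepNum_lt_card
  rw [hcompl, cliqueNum_compl, indepNum_compl, mul_comm] at hlt
  exact hlt.not_ge (card_le_mul_indepNum_of_colorable (hG A))

theorem chromaticNumber_eq_cliqueNum_of_isPerfectGraph [Finite V] (hG : G.IsPerfectGraph) :
    G.chromaticNumber = G.cliqueNum := by
  rw [← chromaticNumber_congr (induceUnivIso G), hG, cliqueNum_congr (induceUnivIso G)]

theorem chromaticNumber_compl_eq_indepNum_of_isPerfectGraph [Finite V] (hG : G.IsPerfectGraph) :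
    Gᶜ.chromaticNumber = G.indepNum := by
  rw [chromaticNumber_eq_cliqueNum_of_isPerfectGraph (isPerfectGraph_compl hG), cliqueNum_compl]

end PerfectGraphs

section TauReductions

open SimpleGraph

variable {V : Type*} {G : SimpleGraph V}

theorem vertexCoverNum_coe_of_coe_eq_top [Finite V] {H : G.Subgraph} (hH : H.coe = ⊤) :
    H.coe.vertexCoverNum = (H.verts.ncard - 1 : ℕ) := by
  rw [hH]
  refine (vertexCoverNum_top (V := H.verts)).trans ?_
  rw [ENat.card_eq_coe_natCard, Nat.card_coe_set_eq, ENat.natCast_sub, Nat.cast_one]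

theorem ncard_sub_one_le_ncard_inter_of_isVertexCover [Finite V] {C : Set V}
    (hC : G.IsVertexCover C) {H : G.Subgraph} (hH : H.coe = ⊤) :
    H.verts.ncard - 1 ≤ (C ∩ H.verts).ncard := by
  have hmissed : (H.verts \ C).ncard ≤ 1 := by
    refine (Set.ncard_le_one (Set.toFinite _)).2 fun a ⟨haH, haC⟩ b ⟨hbH, hbC⟩ => ?_
    by_contra hab
    have hadj : H.coe.Adj ⟨a, haH⟩ ⟨b, hbH⟩ := hH ▸ fun h => hab (congrArg Subtype.val h)
    exact (hC (H.adj_sub hadj)).elim haC hbC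
  have hsplit := Set.ncard_inter_add_ncard_sdiff_eq_ncard H.verts C (Set.toFinite _)
  rw [Set.inter_comm]
  omega

theorem ncard_inter_eq_ncard_sub_one_iff_of_isVertexCover [Finite V] {C : Set V}
    (hC : G.IsVertexCover C) {H : G.Subgraph} (hH : H.coe = ⊤) (hne : H.verts.Nonempty) :
    (C ∩ H.verts).ncard = H.verts.ncard - 1 ↔ ¬ H.verts ⊆ C := by
  have hpos := (Set.ncard_pos (Set.toFinite _)).2 hne
  refine ⟨fun h hHC => ?_, fun h => ?_⟩
  · rw [Set.inter_eq_right.2 hHC] at h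
    omega
  · have hlt : (C ∩ H.verts).ncard < H.verts.ncard := Set.ncard_lt_ncard
      ⟨Set.inter_subset_right, fun hsub => h fun x hx => (hsub hx).1⟩ (Set.toFinite _)
    exact le_antisymm (Nat.le_sub_one_of_lt hlt)
      (ncard_sub_one_le_ncard_inter_of_isVertexCover hC hH)

theorem ncard_eq_sum_ncard_inter [Finite V] {ι : Type*} [Fintype ι] {A : ι → Set V}
    (hdisj : ∀ i j, i ≠ j → Disjoint (A i) (A j)) (hcover : ⋃ i, A i = Set.univ) (C : Set V) :
    C.ncard = ∑ i, (C ∩ A i).ncard := by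
  rw [← finsum_eq_sum_of_fintype, ← Set.ncard_iUnion_of_finite (fun _ => Set.toFinite _)
    fun i j hij => (hdisj i j hij).mono Set.inter_subset_right Set.inter_subset_right,
    ← Set.inter_iUnion, hcover, Set.inter_univ]

section CompletePartition

variable [Finite V] {ι : Type*} [Fintype ι] {H : ι → G.Subgraph} {C : Set V}

theorem sum_vertexCoverNum_le_encard_of_isVertexCover (htop : ∀ i, (H i).coe = ⊤)
    (hdisj : ∀ i j, i ≠ j → Disjoint (H i).verts (H j).verts)
    (hcover : ⋃ i, (H i).verts = Set.univ) (hC : G.IsVertexCover C) :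
    ∑ i, (H i).coe.vertexCoverNum ≤ C.encard := by
  simp only [fun i => vertexCoverNum_coe_of_coe_eq_top (htop i)]
  rw [← Nat.cast_sum, ← (Set.toFinite C).cast_ncard_eq, Nat.cast_le,
    ncard_eq_sum_ncard_inter hdisj hcover C]
  exact Finset.sum_le_sum fun i _ => ncard_sub_one_le_ncard_inter_of_isVertexCover hC (htop i)

theorem encard_eq_sum_vertexCoverNum_iff_of_isVertexCover (htop : ∀ i, (H i).coe = ⊤)
    (hne : ∀ i, (H i).verts.Nonempty) (hdisj : ∀ i j, i ≠ j → Disjoint (H i).verts (H j).verts)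
    (hcover : ⋃ i, (H i).verts = Set.univ) (hC : G.IsVertexCover C) :
    C.encard = ∑ i, (H i).coe.vertexCoverNum ↔ ∀ i, ¬ (H i).verts ⊆ C := by
  simp only [fun i => vertexCoverNum_coe_of_coe_eq_top (htop i)]
  rw [← Nat.cast_sum, ← (Set.toFinite C).cast_ncard_eq, Nat.cast_inj,
    ncard_eq_sum_ncard_inter hdisj hcover C, eq_comm, Finset.sum_eq_sum_iff_of_le fun i _ =>
      ncard_sub_one_le_ncard_inter_of_isVertexCover hC (htop i)]
  simp only [Finset.mem_univ, true_imp_iff, eq_comm (a := _ - 1),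
    fun i => ncard_inter_eq_ncard_sub_one_iff_of_isVertexCover hC (htop i) (hne i)]

end CompletePartition

theorem coe_induce_colorClass_eq_top {α : Type*} (c : Gᶜ.Coloring α) (a : α) :
    ((⊤ : G.Subgraph).induce (c.colorClass a)).coe = ⊤ :=
  (induce_eq_coe_induce_top _).symm.trans
    (induce_eq_top.2 ((isIndepSet_compl G).1 (c.isIndepSet_colorClass a)))

theorem isTauReduction_induce_colorClass [Finite V] (c : Gᶜ.Coloring (Fin G.indepNum)) :
    G.IsTauReduction fun i => (⊤ : G.Subgraph).induce (c.colorClass i) := by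
  obtain ⟨S, hS⟩ := G.exists_isNIndepSet_indepNum
  have hmeet (i) : ∃ v ∈ S, c v = i := by
    have hSc : Gᶜ.IsClique S := (isClique_compl G).2 hS.isIndepSet
    exact c.surjOn_of_card_le_isClique hSc (by rw [Fintype.card_fin, hS.card_eq]) (Set.mem_univ i)
  have hne (i) : (c.colorClass i).Nonempty := (hmeet i).imp fun _ hv => hv.2
  have hdisj (i j) (hij : i ≠ j) : Disjoint (c.colorClass i) (c.colorClass j) :=
    Set.disjoint_left.2 fun _ (hv : c _ = i) (hv' : c _ = j) => hij (hv.symm.trans hv')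
  have hcover : ⋃ i, c.colorClass i = Set.univ :=
    Set.eq_univ_of_forall fun v => Set.mem_iUnion.2 ⟨c v, rfl⟩
  have htop := coe_induce_colorClass_eq_top c
  refine ⟨hne, fun i _ ha _ hb hab => ⟨ha, hb, hab⟩, hdisj, hcover, le_antisymm ?_ ?_⟩
  · have hScover : G.IsVertexCover (S : Set V)ᶜ := isVertexCover_compl.2 hS.isIndepSet
    refine hScover.vertexCoverNum_le.trans_eq
      ((encard_eq_sum_vertexCoverNum_iff_of_isVertexCover htop hne hdisj hcover hScover).2 ?_)
    intro i hi
    obtain ⟨v, hvS, hv⟩ := hmeet i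
    exact hi hv hvS
  · obtain ⟨C, hcard, hC⟩ := vertexCoverNum_exists G
    exact hcard ▸ sum_vertexCoverNum_le_encard_of_isVertexCover htop hdisj hcover hC

end TauReductions

namespace WeightedOrientedGraph

variable {V : Type*} [Finite V] {D : WeightedOrientedGraph V}

theorem isStrongCover_of_encard_eq_vertexCoverNum {C : Set V} (hC : D.G.IsVertexCover C)
    (hcard : C.encard = D.G.vertexCoverNum) : D.IsStrongCover C := by
  refine ⟨hC, fun x hx hN => ?_⟩
  have hle := (isVertexCover_sdiff_singleton hC hN).vertexCoverNum_le
  have hlt : (C \ {x}).encard < C.encard := (Set.toFinite _).encard_lt_encard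
    ⟨Set.sdiff_subset, fun h => (h hx).2 rfl⟩
  exact absurd (hcard ▸ hle) hlt.not_ge

theorem isUnmixedIdeal_edgeIdeal_iff_encard_eq_vertexCoverNum (K : Type*) [Field K] :
    (D.edgeIdeal K).IsUnmixedIdeal ↔
      ∀ C, D.IsStrongCover C → C.encard = D.G.vertexCoverNum := by
  rw [isUnmixedIdeal_edgeIdeal_iff]
  refine ⟨fun h C hC => ?_, fun h C C' hC hC' => (h C hC).trans (h C' hC').symm⟩
  obtain ⟨C₀, hcard, hC₀⟩ := SimpleGraph.vertexCoverNum_exists D.G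
  exact (h C C₀ hC (isStrongCover_of_encard_eq_vertexCoverNum hC₀ hcard)).trans hcard

theorem isUnmixedIdeal_edgeIdeal_iff_of_isTauReduction (K : Type*) [Field K] {s : ℕ}
    {H : Fin s → D.G.Subgraph} (hH : D.G.IsTauReduction H) (htop : ∀ i, (H i).coe = ⊤) :
    (D.edgeIdeal K).IsUnmixedIdeal ↔ ∀ i, ¬ D.HasGeneratingStarSemiForest (H i) := by
  obtain ⟨hne, -, hdisj, hcover, htau⟩ := hH
  have hencard {C : Set V} (hC : D.IsStrongCover C) :
      C.encard = D.G.vertexCoverNum ↔ ∀ i, ¬ (H i).verts ⊆ C := by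
    rw [htau]
    exact encard_eq_sum_vertexCoverNum_iff_of_isVertexCover htop hne hdisj hcover hC.1
  rw [isUnmixedIdeal_edgeIdeal_iff_encard_eq_vertexCoverNum]
  simp only [hasGeneratingStarSemiForest_iff, not_exists, not_and]
  exact ⟨fun h i C hC => (hencard hC).1 (h C hC) i, fun h C hC => (hencard hC).2 fun i => h i C hC⟩

end WeightedOrientedGraph

theorem mainTheorem3_general {V : Type*} [Finite V] (K : Type*) [Field K]
    (D : WeightedOrientedGraph V) :
    (D.Gᶜ.chromaticNumber = D.G.indepNum →
      ∃ (s : ℕ) (c : D.Gᶜ.Coloring (Fin s)),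
        (s : ℕ∞) = D.Gᶜ.chromaticNumber ∧
        D.G.IsTauReduction (fun i => (⊤ : D.G.Subgraph).induce (c.colorClass i)) ∧
        ∀ i, ((⊤ : D.G.Subgraph).induce (c.colorClass i)).coe = ⊤) ∧
    ∀ (s : ℕ) (H : Fin s → D.G.Subgraph),
      D.G.IsTauReduction H → (∀ i, (H i).coe = ⊤) →
      ((D.edgeIdeal K).IsUnmixedIdeal ↔ ∀ i, ¬ D.HasGeneratingStarSemiForest (H i)) := by
  refine ⟨fun hχ => ?_, fun s H =>
    WeightedOrientedGraph.isUnmixedIdeal_edgeIdeal_iff_of_isTauReduction K⟩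
  obtain ⟨c⟩ := SimpleGraph.chromaticNumber_le_iff_colorable.1 hχ.le
  exact ⟨_, c, hχ.symm, isTauReduction_induce_colorClass c, coe_induce_colorClass_eq_top c⟩

/-- If the underlying graph is perfect, then the colour classes of some colouring of the complement
with the least number of colours induce a τ-reduction into complete subgraphs; and for every
τ-reduction into complete subgraphs, the edge ideal is unmixed if and only if no member of the
τ-reduction has a generating ⋆-semi-forest. -/
theorem mainTheorem3 {V : Type*} [Finite V] (K : Type*) [Field K]
    (D : WeightedOrientedGraph V) (hG : D.G.IsPerfectGraph) :
    (∃ (s : ℕ) (c : D.Gᶜ.Coloring (Fin s)),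
      (s : ℕ∞) = D.Gᶜ.chromaticNumber ∧
      D.G.IsTauReduction (fun i => (⊤ : D.G.Subgraph).induce (c.colorClass i)) ∧
      ∀ i, ((⊤ : D.G.Subgraph).induce (c.colorClass i)).coe = ⊤) ∧
    ∀ (s : ℕ) (H : Fin s → D.G.Subgraph),
      D.G.IsTauReduction H → (∀ i, (H i).coe = ⊤) →
      ((D.edgeIdeal K).IsUnmixedIdeal ↔ ∀ i, ¬ D.HasGeneratingStarSemiForest (H i)) :=
  ⟨(mainTheorem3_general K D).1 (chromaticNumber_compl_eq_indepNum_of_isPerfectGraph hG),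
    (mainTheorem3_general K D).2⟩
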